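/- A (finite) temporal digraph $\mathcal G=(G,\gamma,\lambda)$ consists of a finite digraph $G$ (loops and multiple edges allowed), a finite set $\gamma(v)\subseteq\mathbb N$ of times at which $v$ is active for each $v\in V(G)$, and a finite set $\lambda(e)\subseteq\mathbb N\times\mathbb N$ for each edge $e=uv$ of $G$, such that $t\le t'$, $t\in\gamma(u)$ and $t'\in\gamma(v)$ for all $(t,t')\in\lambda(uv)$. Its temporal vertices are the elements of $V_T=\{(v,t): v\in V(G),\ t\in\gamma(v)\}$, and each $(t,t')\in\lambda(uv)$ is a temporal edge from $(u,t)$ to $(v,t')$. A temporal walk is a sequence, beginning and ending in temporal vertices, in which each temporal edge stands between its tail and its head, and in which two consecutive temporal vertices are of the form $(v,t),(v,t+1)$. A temporal subdigraph of $\mathcal G$ is a temporal digraph $\mathcal B=(G',\gamma',\lambda')$ with $G'\subseteq G$, $\gamma'(v)\subseteq\gamma(v)$ and $\lambda'(e)\subseteq\lambda(e)$ for all vertices $v$ and edges $e$ of $G'$. It is a temporal-spanning branching of $\mathcal G$ with root $R\subseteq V_T$ if for each $(u,i)\in V_T$ there is exactly one temporal walk in $\mathcal B$ that starts in an element of $R$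 and ends in $(u,i)$. Two such branchings are edge-disjoint if their base digraphs have no edge in common. Theorem. There is a polynomial-time algorithm for the following problem. Given a temporal digraph $\mathcal G=(G,\gamma,\lambda)$ in which, for every $v\in V(G)$, the set $\gamma(v)$ is an interval of consecutive integers, and given sets $R_1,\dots,R_k\subseteq V_T$ of temporal vertices, find pairwise edge-disjoint temporal-spanning branchings $\mathcal B_1,\dots,\mathcal B_k$ of $\mathcal G$ with roots $R_1,\dots,R_k$, respectively, or report that there are none. In particular, the problem is solvable in polynomial time if all vertices are eternal (that is, for some $T$, $\gamma(v)=\{1,\dots,T\}$ for all $v$), and if the lifetime is at most $2$ (that is, $\gamma(v)\subseteq\{1,2\}$ for all $v$). -/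

import Mathlib

/-! ### Temporal digraphs, temporal walks and temporal-spanning branchings -/

/-- A finite temporal digraph `(G, γ, lam)`. The base digraph `G` has vertex set `V` and edge set `E`;
the edge `e` goes from `src e` to `tgt e`, so loops and multiple edges are allowed. The vertex `v` is
active exactly at the times in `γ v`, and `(t, t') ∈ lam e` says that `e` can be taken leaving `src e`
at time `t` and arriving in `tgt e` at time `t'`. -/
structure TemporalDigraph (V E : Type) where
  src : E → V
  tgt : E → V
  γ : V → Finset ℕ
  lam : E → Finset (ℕ × ℕ)
  lam_le : ∀ e t t', (t, t') ∈ lam e → t ≤ t'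
  lam_src : ∀ e t t', (t, t') ∈ lam e → t ∈ γ (src e)
  lam_tgt : ∀ e t t', (t, t') ∈ lam e → t' ∈ γ (tgt e)

/-- A temporal subdigraph `(G', γ', lam')` of `G`: a subdigraph `G' = (verts, edges)` of the base digraph
with `γ' ⊆ γ` and `lam' ⊆ lam` (pointwise) that is again a temporal digraph. The functions `γ'` and
`lam'` live on `G'`; outside of `G'` they take the value `∅`. -/
structure TemporalSubdigraph {V E : Type} (G : TemporalDigraph V E) where
  verts : Finset V
  edges : Finset E
  src_mem : ∀ e ∈ edges, G.src e ∈ verts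
  tgt_mem : ∀ e ∈ edges, G.tgt e ∈ verts
  γ : V → Finset ℕ
  γ_subset : ∀ v, γ v ⊆ G.γ v
  γ_off : ∀ v, v ∉ verts → γ v = ∅
  lam : E → Finset (ℕ × ℕ)
  lam_subset : ∀ e, lam e ⊆ G.lam e
  lam_off : ∀ e, e ∉ edges → lam e = ∅
  lam_src : ∀ e t t', (t, t') ∈ lam e → t ∈ γ (G.src e)
  lam_tgt : ∀ e t t', (t, t') ∈ lam e → t' ∈ γ (G.tgt e)

/-- The members of the sequence that forms a temporal walk: temporal vertices `(v, t)`, and temporal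
edges, that is, copies `(t, t')` of an edge `e`. -/
inductive WalkItem (V E : Type) where
  | vertex (v : V) (t : ℕ)
  | edge (e : E) (t t' : ℕ)

namespace TemporalSubdigraph

variable {V E : Type} {G : TemporalDigraph V E}

/-- The item is a temporal vertex or a temporal edge of `B`. -/
def HasItem (B : TemporalSubdigraph G) : WalkItem V E → Prop
  | .vertex v t => t ∈ B.γ v
  | .edge e t t' => (t, t') ∈ B.lam e

/-- `(s_1, …, s_l)` is a temporal walk of `B` from the temporal vertex `r` to the temporal vertex `z`. -/
structure IsWalk (B : TemporalSubdigraph G) (r z : V × ℕ) (w : List (WalkItem V E)) : Prop where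
  items : ∀ s ∈ w, B.HasItem s
  chain : w.IsChain fun a b =>
    match a, b with
    -- waiting on an active vertex
    | .vertex v t, .vertex v' t' => v' = v ∧ t' = t + 1
    -- a temporal edge comes after its tail and before its head
    | .vertex v t, .edge e t₁ _ => v = G.src e ∧ t = t₁
    | .edge e _ t₂, .vertex v t => v = G.tgt e ∧ t = t₂
    | .edge _ _ _, .edge _ _ _ => False
  start : w.head? = some (.vertex r.1 r.2)
  finish : w.getLast? = some (.vertex z.1 z.2)

/-- `B` is a temporal-spanning branching of `G` with root `R`: for every temporal vertex `(u, i)` of `G`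
there is exactly one temporal walk in `B` that starts in a member of `R` and arrives in `(u, i)`. -/
def IsTemporalSpanningBranching (B : TemporalSubdigraph G) (R : Finset (V × ℕ)) : Prop :=
  ∀ u : V, ∀ i ∈ G.γ u, ∃! w : List (WalkItem V E), ∃ r ∈ R, B.IsWalk r (u, i) w

/-- No edge of the base digraph belongs to both. -/
def EdgeDisjoint (B₁ B₂ : TemporalSubdigraph G) : Prop :=
  ∀ e : E, ¬ (e ∈ B₁.edges ∧ e ∈ B₂.edges)

end TemporalSubdigraph

/-! ### Polynomial time

The machine model is the WHILE language over binary trees. A program has finitely many variables, each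
of which holds a binary tree. Every elementary operation is charged one unit plus the sizes of all
the trees that it reads, so that the cost bounds the sizes of all trees built and is polynomially related
to the time of a Turing machine. -/

/-- The data: binary trees. -/
inductive BinTree where
  | nil
  | cons (l r : BinTree)
  deriving DecidableEq

namespace BinTree

/-- The number of nodes, leaves included. -/
def size : BinTree → ℕ
  | nil => 1
  | cons l r => 1 + l.size + r.size

def head : BinTree → BinTree
  | nil => nil
  | cons l _ => l

def tail : BinTree → BinTree
  | nil => nil
  | cons _ r => r

/-- A list of trees as a tree. -/
def ofList : List BinTree → BinTree
  | [] => nil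
  | a :: l => cons a (ofList l)

def ofBool : Bool → BinTree
  | false => nil
  | true => cons nil nil

/-- A natural number as a tree, in binary (the list of its binary digits, lowest digit first). -/
def ofNat (n : ℕ) : BinTree := ofList (n.bits.map ofBool)

/-- A pair of natural numbers as a tree. -/
def ofPair (a : ℕ × ℕ) : BinTree := cons (ofNat a.1) (ofNat a.2)

/-- The tree `x` encodes the finite set `s`, that is, a list of its elements in some order. -/
def EncodesSet {α : Type} (code : α → BinTree) (s : Finset α) (x : BinTree) : Prop :=
  ∃ l : List α, (∀ a, a ∈ l ↔ a ∈ s) ∧ x = ofList (l.map code)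

end BinTree

/-- WHILE programs; the variables are named by natural numbers. -/
inductive Cmd where
  | setNil (x : ℕ)
  | copy (x y : ℕ)
  | cons (x y z : ℕ)
  | head (x y : ℕ)
  | tail (x y : ℕ)
  | eq (x y z : ℕ)
  | seq (c d : Cmd)
  | ite (x : ℕ) (c d : Cmd)
  | loop (x : ℕ) (c : Cmd)

/-- `Exec c s s' t`: the program `c`, started with the values `s` of the variables, halts
with the values `s'` after time `t`. In `ite` and `loop`, the tree `nil` counts as false, and
every other tree as true. -/
inductive Exec : Cmd → (ℕ → BinTree) → (ℕ → BinTree) → ℕ → Prop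
  | setNil (x : ℕ) (s : ℕ → BinTree) :
      Exec (.setNil x) s (Function.update s x .nil) 1
  | copy (x y : ℕ) (s : ℕ → BinTree) :
      Exec (.copy x y) s (Function.update s x (s y)) (1 + (s y).size)
  | cons (x y z : ℕ) (s : ℕ → BinTree) :
      Exec (.cons x y z) s (Function.update s x (.cons (s y) (s z))) (1 + (s y).size + (s z).size)
  | head (x y : ℕ) (s : ℕ → BinTree) :
      Exec (.head x y) s (Function.update s x (s y).head) (1 + (s y).size)
  | tail (x y : ℕ) (s : ℕ → BinTree) :
      Exec (.tail x y) s (Function.update s x (s y).tail) (1 + (s y).size)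
  | eq (x y z : ℕ) (s : ℕ → BinTree) :
      Exec (.eq x y z) s (Function.update s x (BinTree.ofBool (decide (s y = s z))))
        (1 + (s y).size + (s z).size)
  | seq {c d : Cmd} {s s' s'' : ℕ → BinTree} {t t' : ℕ} :
      Exec c s s' t → Exec d s' s'' t' → Exec (.seq c d) s s'' (t + t')
  | iteTrue {x : ℕ} {c d : Cmd} {s s' : ℕ → BinTree} {t : ℕ} :
      s x ≠ .nil → Exec c s s' t → Exec (.ite x c d) s s' (1 + t)
  | iteFalse {x : ℕ} {c d : Cmd} {s s' : ℕ → BinTree} {t : ℕ} :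
      s x = .nil → Exec d s s' t → Exec (.ite x c d) s s' (1 + t)
  | loopTrue {x : ℕ} {c : Cmd} {s s' s'' : ℕ → BinTree} {t t' : ℕ} :
      s x ≠ .nil → Exec c s s' t → Exec (.loop x c) s' s'' t' → Exec (.loop x c) s s'' (1 + t + t')
  | loopFalse {x : ℕ} {c : Cmd} {s : ℕ → BinTree} :
      s x = .nil → Exec (.loop x c) s s 1

/-- On the input `x`, given in variable `0` while all other variables hold `nil`, the program `c` halts
after time `t` with the output `y` in variable `0`. -/
def Cmd.Computes (c : Cmd) (x y : BinTree) (t : ℕ) : Prop :=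
  ∃ s', Exec c (Function.update (fun _ => BinTree.nil) 0 x) s' t ∧ s' 0 = y

/-- The search problem with the instances `I : ι` that satisfy `admissible` (written down as in `codeIn`),
and with the solutions `B` of `I` that satisfy `isSol I B` (written down as in `codeOut`), is solvable in
polynomial time: a single program, whose running time is bounded by a polynomial in the size of its
input, outputs a solution if there is one, and reports that there is none otherwise. -/
def SolvableInPolyTime {ι : Type} {σ : ι → Type} (admissible : ι → Prop)
    (codeIn : ι → BinTree → Prop) (isSol : ∀ I : ι, σ I → Prop)
    (codeOut : ∀ I : ι, σ I → BinTree → Prop) : Prop :=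
  ∃ (P : Cmd) (p : Polynomial ℕ), ∀ I : ι, admissible I → ∀ x : BinTree, codeIn I x →
    ∃ (y : BinTree) (t : ℕ), P.Computes x y t ∧ t ≤ p.eval x.size ∧
      ((∃ (B : σ I) (z : BinTree), isSol I B ∧ codeOut I B z ∧ y = .cons .nil z) ∨
        ((∀ B : σ I, ¬ isSol I B) ∧ y = .nil))

/-! ### The problem of finding edge-disjoint temporal-spanning branchings -/

/-- An instance: a temporal digraph with vertices `0, …, n - 1` and edges `0, …, m - 1`, and
sets `R_1, …, R_k` of temporal vertices. -/
structure BranchingInstance where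
  n : ℕ
  m : ℕ
  k : ℕ
  graph : TemporalDigraph (Fin n) (Fin m)
  roots : Fin k → Finset (Fin n × ℕ)
  roots_active : ∀ i, ∀ r ∈ roots i, r.2 ∈ graph.γ r.1

namespace BranchingInstance

/-- The tree `x` encodes the instance: the list of the sets `γ v`, the list of the edges, each with its
tail, its head and the set `lam e`, and the list of the root sets. -/
def Encodes (I : BranchingInstance) (x : BinTree) : Prop :=
  ∃ (g : Fin I.n → BinTree) (h : Fin I.m → BinTree) (r : Fin I.k → BinTree),
    (∀ v, BinTree.EncodesSet BinTree.ofNat (I.graph.γ v) (g v)) ∧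
    (∀ e, BinTree.EncodesSet BinTree.ofPair (I.graph.lam e) (h e)) ∧
    (∀ i, BinTree.EncodesSet (fun a : Fin I.n × ℕ => BinTree.ofPair (a.1.val, a.2))
      (I.roots i) (r i)) ∧
    x = .cons (.ofList (List.ofFn g))
      (.cons
        (.ofList (List.ofFn fun e =>
          .cons (.ofNat (I.graph.src e).val) (.cons (.ofNat (I.graph.tgt e).val) (h e))))
        (.ofList (List.ofFn r)))

/-- The candidate solutions: families of `k` temporal subdigraphs. -/
abbrev Candidate (I : BranchingInstance) : Type := Fin I.k → TemporalSubdigraph I.graph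

/-- `B_1, …, B_k` are pairwise edge-disjoint, and `B_i` is a temporal-spanning branching with root `R_i`. -/
def IsSolution (I : BranchingInstance) (B : I.Candidate) : Prop :=
  (∀ i, (B i).IsTemporalSpanningBranching (I.roots i)) ∧
    ∀ i j, i ≠ j → (B i).EdgeDisjoint (B j)

/-- The tree `z` encodes the temporal subdigraph `B`: the set of its vertices, each with the set of the
times when it is active in `B`, and the set of its edges, each with the set of its copies in `B`. -/
def EncodesSubdigraph {n m : ℕ} {G : TemporalDigraph (Fin n) (Fin m)} (B : TemporalSubdigraph G)
    (z : BinTree) : Prop :=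
  ∃ (g : Fin n → BinTree) (h : Fin m → BinTree) (zv ze : BinTree),
    (∀ v, BinTree.EncodesSet BinTree.ofNat (B.γ v) (g v)) ∧
    (∀ e, BinTree.EncodesSet BinTree.ofPair (B.lam e) (h e)) ∧
    BinTree.EncodesSet (fun v : Fin n => .cons (.ofNat v.val) (g v)) B.verts zv ∧
    BinTree.EncodesSet (fun e : Fin m => .cons (.ofNat e.val) (h e)) B.edges ze ∧
    z = .cons zv ze

/-- The tree `z` encodes the family `B_1, …, B_k`. -/
def EncodesCandidate (I : BranchingInstance) (B : I.Candidate) (z : BinTree) : Prop :=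
  ∃ b : Fin I.k → BinTree, (∀ i, EncodesSubdigraph (B i) (b i)) ∧ z = .ofList (List.ofFn b)

/-- The set of times when a vertex is active is an interval of consecutive integers, for every vertex. -/
def IntervalActivity (I : BranchingInstance) : Prop :=
  ∀ v, ∀ a ∈ I.graph.γ v, ∀ b ∈ I.graph.γ v, ∀ t, a ≤ t → t ≤ b → t ∈ I.graph.γ v

/-- All vertices are eternal: they are active at all the times `1, …, T`. -/
def EternalVertices (I : BranchingInstance) : Prop :=
  ∃ T : ℕ, ∀ v, I.graph.γ v = Finset.Icc 1 T

/-- The lifetime is at most 2, where the first time is `1`. -/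
def LifetimeTwo (I : BranchingInstance) : Prop :=
  ∀ v, I.graph.γ v ⊆ Finset.Icc 1 2

/-- Finding `k` edge-disjoint temporal-spanning branchings with given root sets can be done in
polynomial time on the instances that satisfy `admissible`. -/
def PolyTimeOn (admissible : BranchingInstance → Prop) : Prop :=
  SolvableInPolyTime (σ := Candidate) admissible Encodes IsSolution EncodesCandidate

end BranchingInstance

/-!
A branching `B` that reaches all temporal vertices keeps all of them, so a walk may wait at a vertex as
long as the vertex is active. If the times of each vertex form an interval, then, by uniqueness of walks, every
temporal vertex `(v, t)` other than the first one of `v` is reached by waiting only. Hence all roots and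
all ends of temporal edges of `B` are of the form `(v, t)` with `t` the first time of `v`, and at most one
temporal edge of `B` ends there. So the problem is about disjoint branchings in the static digraph of those
edges which have a copy that arrives at the first time of its head (`Listing.solve_sound`,
`Listing.cutCondition_of_isSolution`).

For that problem, a branching for a root set `R` is grown edge by edge, as in Lovász's proof of Edmonds'
theorem. The condition that each set `X` is entered by as many edges as there are root sets disjoint from
`X` is kept for the remaining edges and the roots, where the set reached so far counts as a root set. A
suitable edge exists by uncrossing (`CutCondition.exists_edge`). The condition is tested with Menger's
theorem (`flowTest_iff`, `cutTest_iff`): add a source for each root set, and for each vertex look for paths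
from the sources, reversing the edges of each path that is found; a reversal changes indegrees of sets only
according to the ends of the path, so that neither flows nor residual digraphs are needed.

For the running time, `PolyFun` is the class of the functions that a WHILE program computes in polynomial
time. It is closed under composition and under folds over lists whose accumulators stay small
(`PolyFun.foldl_of_growth`). The algorithm is written as an ordinary function `solve` on lists, and
`PolyFun.solve` follows its definition.
-/

/-! ### Running times and variable renaming -/

namespace BinTree

theorem one_le_size (x : BinTree) : 1 ≤ x.size := by
  cases x <;> simp only [size] <;> omega

theorem size_head_le (x : BinTree) : x.head.size ≤ x.size := by
  cases x <;> simp only [size, head] <;> omega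

theorem size_tail_le (x : BinTree) : x.tail.size ≤ x.size := by
  cases x <;> simp only [size, tail] <;> omega

theorem size_ofBool_le (b : Bool) : (ofBool b).size ≤ 3 := by
  cases b <;> simp [ofBool, size]

theorem ofBool_ne_nil {b : Bool} : ofBool b ≠ nil ↔ b = true := by
  cases b <;> simp [ofBool]

theorem ofList_injective : Function.Injective ofList := by
  intro l
  induction l with
  | nil => intro l' h; cases l' with
    | nil => rfl
    | cons a l' => simp [ofList] at h
  | cons a l ih => intro l' h; cases l' with
    | nil => simp [ofList] at h
    | cons b l' =>
      simp only [ofList, cons.injEq] at h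
      rw [h.1, ih h.2]

theorem ofBool_injective : Function.Injective ofBool := by
  intro a b h
  cases a <;> cases b <;> simp_all [ofBool]

theorem ofNat_injective : Function.Injective ofNat := fun a b h => by
  have h1 : a.bits = b.bits := (List.map_injective_iff.2 ofBool_injective) (ofList_injective h)
  have h2 : ∀ n : ℕ, Nat.ofDigits 2 (n.bits.map fun b => cond b 1 0) = n := fun n => by
    rw [← Nat.digits_two_eq_bits, Nat.ofDigits_digits]
  rw [← h2 a, ← h2 b, h1]

end BinTree

/-- The program `c` with every variable `x` renamed to `x + m`. -/
def Cmd.shift (m : ℕ) : Cmd → Cmd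
  | .setNil x => .setNil (x + m)
  | .copy x y => .copy (x + m) (y + m)
  | .cons x y z => .cons (x + m) (y + m) (z + m)
  | .head x y => .head (x + m) (y + m)
  | .tail x y => .tail (x + m) (y + m)
  | .eq x y z => .eq (x + m) (y + m) (z + m)
  | .seq c d => .seq (c.shift m) (d.shift m)
  | .ite x c d => .ite (x + m) (c.shift m) (d.shift m)
  | .loop x c => .loop (x + m) (c.shift m)

theorem Exec.update_shift {S s : ℕ → BinTree} {m : ℕ} (h : ∀ i, S (i + m) = s i) (x : ℕ) (v : BinTree) :
    (∀ i, Function.update S (x + m) v (i + m) = Function.update s x v i) ∧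
      ∀ j < m, Function.update S (x + m) v j = S j := by
  refine ⟨fun i => ?_, fun j hj => ?_⟩
  · by_cases hi : i = x
    · subst hi; simp
    · rw [Function.update_of_ne (by omega), Function.update_of_ne hi, h]
  · rw [Function.update_of_ne (by omega)]

/-- A renamed program does the same work on the variables from `m` on, and leaves the others alone. -/
theorem Exec.shift {c : Cmd} {s s' : ℕ → BinTree} {t : ℕ} (h : Exec c s s' t) (m : ℕ) :
    ∀ S : ℕ → BinTree, (∀ i, S (i + m) = s i) →
      ∃ S', Exec (c.shift m) S S' t ∧ (∀ i, S' (i + m) = s' i) ∧ ∀ j < m, S' j = S j := by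
  induction h with
  | setNil x s => exact fun S hS => ⟨_, .setNil _ _, update_shift hS x _⟩
  | copy x y s => exact fun S hS => ⟨_, hS y ▸ .copy _ _ _, update_shift hS x _⟩
  | cons x y z s => exact fun S hS => ⟨_, hS y ▸ hS z ▸ .cons _ _ _ _, update_shift hS x _⟩
  | head x y s => exact fun S hS => ⟨_, hS y ▸ .head _ _ _, update_shift hS x _⟩
  | tail x y s => exact fun S hS => ⟨_, hS y ▸ .tail _ _ _, update_shift hS x _⟩
  | eq x y z s => exact fun S hS => ⟨_, hS y ▸ hS z ▸ .eq _ _ _ _, update_shift hS x _⟩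
  | seq _ _ ih₁ ih₂ =>
    intro S hS
    obtain ⟨S₁, e₁, h₁, k₁⟩ := ih₁ S hS
    obtain ⟨S₂, e₂, h₂, k₂⟩ := ih₂ S₁ h₁
    exact ⟨S₂, .seq e₁ e₂, h₂, fun j hj => (k₂ j hj).trans (k₁ j hj)⟩
  | iteTrue hx _ ih =>
    intro S hS
    obtain ⟨S₁, e₁, h₁⟩ := ih S hS
    exact ⟨S₁, .iteTrue (by rwa [hS]) e₁, h₁⟩
  | iteFalse hx _ ih =>
    intro S hS
    obtain ⟨S₁, e₁, h₁⟩ := ih S hS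
    exact ⟨S₁, .iteFalse (by rwa [hS]) e₁, h₁⟩
  | loopTrue hx _ _ ih₁ ih₂ =>
    intro S hS
    obtain ⟨S₁, e₁, h₁, k₁⟩ := ih₁ S hS
    obtain ⟨S₂, e₂, h₂, k₂⟩ := ih₂ S₁ h₁
    exact ⟨S₂, .loopTrue (by rwa [hS]) e₁ e₂, h₂, fun j hj => (k₂ j hj).trans (k₁ j hj)⟩
  | loopFalse hx => exact fun S hS => ⟨S, .loopFalse (by rwa [hS]), hS, fun _ _ => rfl⟩

theorem Exec.size_update_le {s : ℕ → BinTree} {x : ℕ} {v : BinTree} {t : ℕ} (h : v.size ≤ t) (z : ℕ) :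
    (Function.update s x v z).size ≤ max (s z).size t := by
  by_cases hz : z = x
  · subst hz; simp [h]
  · simp [Function.update_of_ne hz]

/-- Every tree that is built has been paid for. -/
theorem Exec.size_le {c : Cmd} {s s' : ℕ → BinTree} {t : ℕ} (h : Exec c s s' t) (x : ℕ) :
    (s' x).size ≤ max (s x).size t := by
  induction h with
  | setNil => exact size_update_le (by simp [BinTree.size]) _
  | copy => exact size_update_le (by omega) _
  | cons => exact size_update_le (by simp [BinTree.size]) _
  | head x y s => exact size_update_le (by have := (s y).size_head_le; omega) _
  | tail x y s => exact size_update_le (by have := (s y).size_tail_le; omega) _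
  | eq x y z s =>
    refine size_update_le ((BinTree.size_ofBool_le _).trans ?_) _
    have := (s y).one_le_size
    have := (s z).one_le_size
    omega
  | seq => omega
  | iteTrue => omega
  | iteFalse => omega
  | loopTrue => omega
  | loopFalse => omega

theorem Polynomial.eval_nat_mono (p : Polynomial ℕ) {a b : ℕ} (h : a ≤ b) : p.eval a ≤ p.eval b := by
  rw [Polynomial.eval_eq_sum, Polynomial.eval_eq_sum]
  exact Finset.sum_le_sum fun i _ => Nat.mul_le_mul_left _ (Nat.pow_le_pow_left h i)

/-! ### Encodings and polynomial-time functions -/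

/-- A type whose elements are written as binary trees. -/
class Enc (α : Type) where
  enc : α → BinTree
  enc_injective : Function.Injective enc

open Enc

instance : Enc BinTree := ⟨id, Function.injective_id⟩

instance : Enc Bool := ⟨BinTree.ofBool, BinTree.ofBool_injective⟩

instance : Enc Unit := ⟨fun _ => .nil, fun _ _ _ => rfl⟩

instance : Enc ℕ := ⟨BinTree.ofNat, BinTree.ofNat_injective⟩

instance {α β : Type} [Enc α] [Enc β] : Enc (α × β) :=
  ⟨fun a => .cons (enc a.1) (enc a.2), fun a b h => by
    simp only [BinTree.cons.injEq] at h
    exact Prod.ext (enc_injective h.1) (enc_injective h.2)⟩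

instance {α : Type} [Enc α] : Enc (List α) :=
  ⟨fun l => .ofList (l.map enc), fun _ _ h =>
    (List.map_injective_iff.2 enc_injective) (BinTree.ofList_injective h)⟩

instance {α : Type} [Enc α] : Enc (Option α) :=
  ⟨fun a => a.elim .nil fun b => .cons .nil (enc b), fun a b h => by
    cases a <;> cases b <;> simp_all [enc_injective.eq_iff]⟩

instance {α β : Type} [Enc α] [Enc β] : Enc (α ⊕ β) :=
  ⟨Sum.elim (fun a => .cons .nil (enc a)) fun b => .cons (.cons .nil .nil) (enc b), fun a b h => by
    cases a <;> cases b <;> simp_all [enc_injective.eq_iff]⟩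

/-- The size of the code of `a`. -/
def esize {α : Type} [Enc α] (a : α) : ℕ := (enc a).size

section esize

variable {α β : Type} [Enc α] [Enc β]

theorem size_enc (a : α) : (enc a).size = esize a := rfl

theorem one_le_esize (a : α) : 1 ≤ esize a := BinTree.one_le_size _

@[simp] theorem esize_prod (a : α) (b : β) : esize (a, b) = 1 + esize a + esize b := rfl

@[simp] theorem esize_nil : esize ([] : List α) = 1 := rfl

@[simp] theorem esize_cons (a : α) (l : List α) : esize (a :: l) = 1 + esize a + esize l := rfl

@[simp] theorem esize_none : esize (none : Option α) = 1 := rfl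

@[simp] theorem esize_some (a : α) : esize (some a) = 2 + esize a := rfl

theorem esize_bool_le (b : Bool) : esize b ≤ 3 := BinTree.size_ofBool_le b

theorem esize_append (l l' : List α) : esize (l ++ l') + 1 = esize l + esize l' := by
  induction l with
  | nil => simp; omega
  | cons a l ih => simp only [List.cons_append, esize_cons]; omega

theorem esize_perm {l l' : List α} (h : l.Perm l') : esize l = esize l' := by
  induction h with
  | nil => rfl
  | cons a _ ih => simp [ih]
  | swap a b l => simp; omega
  | trans _ _ ih₁ ih₂ => exact ih₁.trans ih₂

theorem esize_le_of_mem {a : α} {l : List α} (h : a ∈ l) : esize a + 1 ≤ esize l := by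
  induction l with
  | nil => simp at h
  | cons b l ih =>
    rcases List.mem_cons.1 h with rfl | h
    · simp; omega
    · have := ih h; simp; omega

theorem length_le_esize (l : List α) : l.length + 1 ≤ esize l := by
  induction l with
  | nil => simp
  | cons b l ih => have := one_le_esize b; simp; omega

end esize

/-- `f` is computed by a program in polynomial time. The input and the output are in variable `0`, and
the program may not rely on the initial values of the other variables, so that programs can be
put one after the other. -/
def PolyFun {α β : Type} [Enc α] [Enc β] (f : α → β) : Prop :=
  ∃ (c : Cmd) (p : Polynomial ℕ), ∀ (a : α) (s : ℕ → BinTree), s 0 = enc a →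
    ∃ (s' : ℕ → BinTree) (t : ℕ), Exec c s s' t ∧ s' 0 = enc (f a) ∧ t ≤ p.eval (esize a)

namespace PolyFun

variable {α β γ δ σ : Type} [Enc α] [Enc β] [Enc γ] [Enc δ] [Enc σ]

/-- A version that reads and writes variable `m` and leaves the variables below `m` alone. -/
theorem exists_at {f : α → β} (hf : PolyFun f) (m : ℕ) :
    ∃ (c : Cmd) (p : Polynomial ℕ), ∀ (a : α) (s : ℕ → BinTree), s m = enc a →
      ∃ (s' : ℕ → BinTree) (t : ℕ), Exec c s s' t ∧ s' m = enc (f a) ∧ (∀ j < m, s' j = s j) ∧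
        t ≤ p.eval (esize a) := by
  obtain ⟨c, p, h⟩ := hf
  refine ⟨c.shift m, p, fun a s hs => ?_⟩
  obtain ⟨s', t, e, h0, ht⟩ := h a (fun i => s (i + m)) (by simpa using hs)
  obtain ⟨S', E, h1, h2⟩ := e.shift m s fun _ => rfl
  exact ⟨S', t, E, by rw [← h0, ← h1, Nat.zero_add], h2, ht⟩

theorem exists_esize_le {f : α → β} (hf : PolyFun f) :
    ∃ p : Polynomial ℕ, ∀ a, esize (f a) ≤ p.eval (esize a) := by
  obtain ⟨c, p, h⟩ := hf
  refine ⟨p + .X, fun a => ?_⟩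
  obtain ⟨s', t, e, h0, ht⟩ := h a (fun _ => enc a) rfl
  have := e.size_le 0
  rw [h0] at this
  simp only [Polynomial.eval_add, Polynomial.eval_X]
  simp only [esize] at *
  omega

/-- Only the codes of the values matter. -/
theorem of_enc_eq {f : α → β} {g : α → γ} (hf : PolyFun f) (h : ∀ a, enc (g a) = enc (f a)) :
    PolyFun g := by
  obtain ⟨c, p, hc⟩ := hf
  exact ⟨c, p, by simpa only [h] using hc⟩

protected theorem id : PolyFun (fun a : α => a) :=
  ⟨.copy 0 0, 1 + .X, fun a s hs => ⟨_, _, .copy _ _ _, by simp [hs], by simp [hs, esize]⟩⟩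

theorem comp {g : β → γ} {f : α → β} (hg : PolyFun g) (hf : PolyFun f) :
    PolyFun (fun a => g (f a)) := by
  obtain ⟨q, hq⟩ := hf.exists_esize_le
  obtain ⟨c, p, hc⟩ := hf
  obtain ⟨d, r, hd⟩ := hg
  refine ⟨.seq c d, p + r.comp q, fun a s hs => ?_⟩
  obtain ⟨s₁, t₁, e₁, h₁, b₁⟩ := hc a s hs
  obtain ⟨s₂, t₂, e₂, h₂, b₂⟩ := hd _ s₁ h₁
  refine ⟨s₂, _, .seq e₁ e₂, h₂, ?_⟩
  have := r.eval_nat_mono (hq a)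
  simp only [Polynomial.eval_add, Polynomial.eval_comp]
  omega

theorem fst {f : α → β × γ} (hf : PolyFun f) : PolyFun (fun a => (f a).1) :=
  comp (g := Prod.fst) ⟨.head 0 0, 1 + .X, fun a s hs =>
    ⟨_, _, .head _ _ _, by rw [Function.update_self, hs]; rfl, by simp [hs, esize]⟩⟩ hf

theorem snd {f : α → β × γ} (hf : PolyFun f) : PolyFun (fun a => (f a).2) :=
  comp (g := Prod.snd) ⟨.tail 0 0, 1 + .X, fun a s hs =>
    ⟨_, _, .tail _ _ _, by rw [Function.update_self, hs]; rfl, by simp [hs, esize]⟩⟩ hf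

theorem pair {f : α → β} {g : α → γ} (hf : PolyFun f) (hg : PolyFun g) :
    PolyFun (fun a => (f a, g a)) := by
  obtain ⟨qf, hqf⟩ := hf.exists_esize_le
  obtain ⟨qg, hqg⟩ := hg.exists_esize_le
  obtain ⟨c, p, hc⟩ := hf.exists_at 1
  obtain ⟨d, r, hd⟩ := hg.exists_at 2
  refine ⟨.seq (.copy 1 0) (.seq c (.seq (.copy 2 0) (.seq d (.cons 0 1 2)))),
    p + r + qf + qg + .C 2 * .X + .C 3, fun a s hs => ?_⟩
  obtain ⟨s₁, t₁, e₁, h₁, k₁, b₁⟩ := hc a (Function.update s 1 (s 0)) (by simp [hs])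
  have hs₁ : s₁ 0 = enc a := by rw [k₁ 0 (by norm_num), Function.update_of_ne (by norm_num), hs]
  obtain ⟨s₂, t₂, e₂, h₂, k₂, b₂⟩ := hd a (Function.update s₁ 2 (s₁ 0)) (by simp [hs₁])
  have hs₂ : s₂ 1 = enc (f a) := by
    rw [k₂ 1 (by norm_num), Function.update_of_ne (by norm_num), h₁]
  refine ⟨_, _, .seq (.copy _ _ _) (.seq e₁ (.seq (.copy _ _ _) (.seq e₂ (.cons _ _ _ _)))), ?_, ?_⟩
  · rw [Function.update_self, hs₂, h₂]; rfl
  · have := hqf a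
    have := hqg a
    rw [hs, hs₁, hs₂, h₂]
    simp only [Polynomial.eval_add, Polynomial.eval_X, Polynomial.eval_mul, Polynomial.eval_C]
    simp only [esize] at *
    omega

theorem const (b : β) : PolyFun (fun _ : α => b) := by
  suffices h : ∀ x : BinTree, PolyFun (fun _ : α => x) from (h (enc b)).of_enc_eq fun _ => rfl
  intro x
  induction x with
  | nil => exact ⟨.setNil 0, 1, fun a s hs => ⟨_, _, .setNil _ _, by simp [enc], by simp⟩⟩
  | cons l r hl hr => exact (hl.pair hr).of_enc_eq fun _ => rfl

theorem decide_eq [DecidableEq β] {f g : α → β} (hf : PolyFun f) (hg : PolyFun g) :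
    PolyFun (fun a => decide (f a = g a)) := by
  have h : PolyFun (fun a : β × β => decide (a.1 = a.2)) := by
    refine ⟨.seq (.head 1 0) (.seq (.tail 2 0) (.eq 0 1 2)), .C 4 * .X + .C 3, fun a s hs => ?_⟩
    refine ⟨_, _, .seq (.head _ _ _) (.seq (.tail _ _ _) (.eq _ _ _ _)), ?_, ?_⟩
    · simp [hs, enc, BinTree.head, BinTree.tail, enc_injective.eq_iff]
    · have h₁ := (enc a).size_head_le
      have h₂ := (enc a).size_tail_le
      simp [hs, esize]
      omega
  exact h.comp (hf.pair hg)

theorem ite {f : α → Bool} {g h : α → β} (hf : PolyFun f) (hg : PolyFun g) (hh : PolyFun h) :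
    PolyFun (fun a => if f a then g a else h a) := by
  obtain ⟨c, p, hc⟩ := hf.exists_at 1
  obtain ⟨d, q, hd⟩ := hg
  obtain ⟨e, r, he⟩ := hh
  refine ⟨.seq (.copy 1 0) (.seq c (.ite 1 d e)), p + q + r + .X + .C 2, fun a s hs => ?_⟩
  obtain ⟨s₁, t₁, e₁, h₁, k₁, b₁⟩ := hc a (Function.update s 1 (s 0)) (by simp [hs])
  have hs₁ : s₁ 0 = enc a := by rw [k₁ 0 (by norm_num), Function.update_of_ne (by norm_num), hs]
  cases hfa : f a with
  | true =>
    obtain ⟨s₂, t₂, e₂, h₂, b₂⟩ := hd a s₁ hs₁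
    refine ⟨s₂, _, .seq (.copy _ _ _) (.seq e₁ (.iteTrue ?_ e₂)), by simpa [hfa] using h₂, ?_⟩
    · rw [h₁]; exact BinTree.ofBool_ne_nil.2 hfa
    · simp [hs]
      simp only [esize] at *
      omega
  | false =>
    obtain ⟨s₂, t₂, e₂, h₂, b₂⟩ := he a s₁ hs₁
    refine ⟨s₂, _, .seq (.copy _ _ _) (.seq e₁ (.iteFalse ?_ e₂)), by simpa [hfa] using h₂, ?_⟩
    · rw [h₁, hfa]; rfl
    · simp [hs]
      simp only [esize] at *
      omega

theorem optionElim {f : α → Option β} {g : α → γ} {h : α → β → γ} (hf : PolyFun f) (hg : PolyFun g)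
    (hh : PolyFun fun x : α × β => h x.1 x.2) : PolyFun (fun a => (f a).elim (g a) (h a)) := by
  obtain ⟨qf, hqf⟩ := hf.exists_esize_le
  obtain ⟨c, p, hc⟩ := hf.exists_at 1
  obtain ⟨d, q, hd⟩ := hg
  obtain ⟨e, r, he⟩ := hh
  refine ⟨.seq (.copy 1 0) (.seq c (.ite 1 (.seq (.tail 1 1) (.seq (.cons 0 0 1) e)) d)),
    p + q + r.comp (1 + .X + qf) + .C 2 * qf + .C 2 * .X + .C 4, fun a s hs => ?_⟩
  obtain ⟨s₁, t₁, e₁, h₁, k₁, b₁⟩ := hc a (Function.update s 1 (s 0)) (by simp [hs])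
  have hs₁ : s₁ 0 = enc a := by rw [k₁ 0 (by norm_num), Function.update_of_ne (by norm_num), hs]
  have hsf := hqf a
  cases hfa : f a with
  | none =>
    obtain ⟨s₂, t₂, e₂, h₂, b₂⟩ := hd a s₁ hs₁
    refine ⟨s₂, _, .seq (.copy _ _ _) (.seq e₁ (.iteFalse ?_ e₂)), by simpa [hfa] using h₂, ?_⟩
    · rw [h₁, hfa]; rfl
    · simp [hs]
      simp only [esize] at *
      omega
  | some b =>
    rw [hfa] at h₁ hsf
    obtain ⟨s₂, t₂, e₂, h₂, b₂⟩ := he (a, b)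
      (Function.update (Function.update s₁ 1 (s₁ 1).tail) 0 (.cons (s₁ 0) (s₁ 1).tail))
      (by rw [Function.update_self, h₁, hs₁]; rfl)
    have e₂' : Exec e (Function.update (Function.update s₁ 1 (s₁ 1).tail) 0
        (.cons (Function.update s₁ 1 (s₁ 1).tail 0) (Function.update s₁ 1 (s₁ 1).tail 1))) s₂ t₂ := by
      simpa using e₂
    refine ⟨s₂, _, .seq (.copy _ _ _) (.seq e₁ (.iteTrue ?_
      (.seq (.tail _ _ _) (.seq (.cons _ _ _ _) e₂')))), by simpa [hfa] using h₂, ?_⟩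
    · rw [h₁]; simp [enc]
    · have hm := r.eval_nat_mono (show esize (a, b) ≤ 1 + esize a + qf.eval (esize a) by
        simp at hsf ⊢; omega)
      have ht : (enc (Option.some b)).tail = enc b := rfl
      simp [hs, hs₁, Polynomial.eval_comp, h₁, ht]
      simp only [size_enc, esize_some] at *
      omega

theorem some {f : α → β} (hf : PolyFun f) : PolyFun (fun a => Option.some (f a)) :=
  ((const BinTree.nil).pair hf).of_enc_eq fun _ => rfl

theorem inl {f : α → β} (hf : PolyFun f) : PolyFun (fun a => (Sum.inl (f a) : β ⊕ γ)) :=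
  ((const BinTree.nil).pair hf).of_enc_eq fun _ => rfl

theorem inr {f : α → γ} (hf : PolyFun f) : PolyFun (fun a => (Sum.inr (f a) : β ⊕ γ)) :=
  ((const (BinTree.cons .nil .nil)).pair hf).of_enc_eq fun _ => rfl

theorem cons {f : α → β} {g : α → List β} (hf : PolyFun f) (hg : PolyFun g) :
    PolyFun (fun a => f a :: g a) :=
  (hf.pair hg).of_enc_eq fun _ => rfl

theorem listTail {f : α → List β} (hf : PolyFun f) : PolyFun (fun a => (f a).tail) :=
  comp (g := List.tail) ⟨.tail 0 0, 1 + .X, fun a s hs =>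
    ⟨_, _, .tail _ _ _, by rw [Function.update_self, hs]; cases a <;> rfl, by simp [hs, esize]⟩⟩ hf

theorem and {f g : α → Bool} (hf : PolyFun f) (hg : PolyFun g) : PolyFun (fun a => f a && g a) :=
  (hf.ite hg (const false)).of_enc_eq fun a => by cases f a <;> rfl

theorem not {f : α → Bool} (hf : PolyFun f) : PolyFun (fun a => !f a) :=
  (hf.ite (const false) (const true)).of_enc_eq fun a => by cases f a <;> rfl

/-- The loop that runs through a list, with `a` in variable `0`, the rest of the list in variable `1`, and
the accumulator in variable `2`; the number `M` bounds the sizes of all of them. -/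
theorem exec_loop {h : α → σ → β → σ} {c : Cmd} {p : Polynomial ℕ}
    (hc : ∀ (x : α × σ × β) (s : ℕ → BinTree), s 3 = enc x →
      ∃ (s' : ℕ → BinTree) (t : ℕ), Exec c s s' t ∧ s' 3 = enc (h x.1 x.2.1 x.2.2) ∧
        (∀ j < 3, s' j = s j) ∧ t ≤ p.eval (esize x))
    {a : α} {M : ℕ} (ha : esize a ≤ M) (l : List β) :
    ∀ (st : σ) (s : ℕ → BinTree), s 0 = enc a → s 1 = enc l → s 2 = enc st → esize l ≤ M →
      (∀ l', l' <+: l → esize (l'.foldl (h a) st) ≤ M) →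
      ∃ (s' : ℕ → BinTree) (t : ℕ),
        Exec (.loop 1 (.seq (.head 3 1) (.seq (.tail 1 1) (.seq (.cons 3 2 3) (.seq (.cons 3 0 3)
          (.seq c (.copy 2 3))))))) s s' t ∧ s' 2 = enc (l.foldl (h a) st) ∧
        t ≤ l.length * (p.eval (3 * M + 2) + 8 * M + 10) + 1 := by
  induction l with
  | nil => exact fun st s _ h1 h2 _ _ => ⟨s, 1, .loopFalse (by rw [h1]; rfl), h2, by simp⟩
  | cons b l ih =>
    intro st s h0 h1 h2 hl hM
    have hst : esize st ≤ M := hM [] (List.nil_prefix)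
    have hst' : esize (h a st b) ≤ M := hM [b] (by simp)
    have hb : esize b + esize l + 1 ≤ M := by simp at hl; omega
    have hhead : (enc (b :: l)).head = enc b := rfl
    have htail : (enc (b :: l)).tail = enc l := rfl
    obtain ⟨s₁, t₁, e₁, r₁, k₁, b₁⟩ := hc (a, st, b)
      (Function.update (Function.update (Function.update (Function.update s 3 (enc b)) 1 (enc l)) 3
        (.cons (enc st) (enc b))) 3 (.cons (enc a) (.cons (enc st) (enc b)))) (by simp; rfl)
    obtain ⟨s₂, t₂, e₂, r₂, b₂⟩ := ih (h a st b) (Function.update s₁ 2 (s₁ 3))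
      (by simp [k₁ 0, h0]) (by simp [k₁ 1]) (by simp [r₁]) (by omega)
      (fun l' hl' => by simpa using hM (b :: l') (by simpa using hl'))
    have E := Exec.seq (.head 3 1 s) (.seq (.tail 1 1 _) (.seq (.cons 3 2 3 _) (.seq (.cons 3 0 3 _)
      (.seq (s' := s₁) (t := t₁) (c := c) (by simpa [h0, h1, h2, hhead, htail] using e₁)
        (.copy 2 3 _)))))
    refine ⟨s₂, _, .loopTrue (by rw [h1]; simp [enc, BinTree.ofList]) E e₂, by simpa using r₂, ?_⟩
    have hm := p.eval_nat_mono (show esize (a, st, b) ≤ 3 * M + 2 by simp; omega)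
    rw [r₁]
    simp only [h0, h1, h2, hhead, htail, Function.update_self, ne_eq, OfNat.ofNat_ne_one,
      OfNat.one_ne_ofNat, OfNat.zero_ne_ofNat, zero_ne_one,
      not_false_eq_true, Function.update_of_ne, Nat.reduceEqDiff, BinTree.size]
    simp only [size_enc, esize_cons, List.length_cons] at *
    rw [Nat.add_mul]
    omega

/-- A fold takes polynomial time if each step does and the accumulators stay small. -/
theorem foldl {f : α → List β} {g : α → σ} {h : α → σ → β → σ} (hf : PolyFun f) (hg : PolyFun g)
    (hh : PolyFun fun x : α × σ × β => h x.1 x.2.1 x.2.2)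
    (hb : ∃ q : Polynomial ℕ, ∀ a l, l <+: f a → esize (l.foldl (h a) (g a)) ≤ q.eval (esize a)) :
    PolyFun (fun a => (f a).foldl (h a) (g a)) := by
  obtain ⟨qf, hqf⟩ := hf.exists_esize_le
  obtain ⟨q, hq⟩ := hb
  obtain ⟨c, p, hc⟩ := hf.exists_at 1
  obtain ⟨d, r, hd⟩ := hg.exists_at 2
  obtain ⟨e, u, he⟩ := hh.exists_at 3
  refine ⟨.seq (.copy 1 0) (.seq c (.seq (.copy 2 0) (.seq d (.seq (.loop 1 (.seq (.head 3 1)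
    (.seq (.tail 1 1) (.seq (.cons 3 2 3) (.seq (.cons 3 0 3) (.seq e (.copy 2 3))))))) (.copy 0 2))))),
    p + r + q + .C 2 * .X + .C 4 + qf * (u.comp (.C 3 * (.X + q + qf) + .C 2)
      + .C 8 * (.X + q + qf) + .C 10), fun a s hs => ?_⟩
  obtain ⟨s₁, t₁, e₁, h₁, k₁, b₁⟩ := hc a (Function.update s 1 (s 0)) (by simp [hs])
  have hs₁ : s₁ 0 = enc a := by rw [k₁ 0 (by norm_num), Function.update_of_ne (by norm_num), hs]
  obtain ⟨s₂, t₂, e₂, h₂, k₂, b₂⟩ := hd a (Function.update s₁ 2 (s₁ 0)) (by simp [hs₁])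
  have hs₂ : s₂ 1 = enc (f a) := by
    rw [k₂ 1 (by norm_num), Function.update_of_ne (by norm_num), h₁]
  have hs₂' : s₂ 0 = enc a := by
    rw [k₂ 0 (by norm_num), Function.update_of_ne (by norm_num), hs₁]
  have hqfa := hqf a
  obtain ⟨s₃, t₃, e₃, h₃, b₃⟩ := exec_loop he (a := a)
    (M := esize a + q.eval (esize a) + qf.eval (esize a)) (by omega) (f a) (g a) s₂ hs₂' hs₂ h₂
    (by omega) (fun l' hl' => by have := hq a l' hl'; omega)
  refine ⟨_, _, .seq (.copy _ _ _) (.seq e₁ (.seq (.copy _ _ _) (.seq e₂ (.seq e₃ (.copy _ _ _))))),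
    by simpa using h₃, ?_⟩
  have hout := hq a (f a) List.prefix_rfl
  have hlen := length_le_esize (f a)
  have hmul := Nat.mul_le_mul_right (u.eval (3 * (esize a + q.eval (esize a) + qf.eval (esize a)) + 2)
    + 8 * (esize a + q.eval (esize a) + qf.eval (esize a)) + 10)
    (show (f a).length ≤ qf.eval (esize a) by omega)
  rw [hs, hs₁, h₃]
  simp only [Polynomial.eval_add, Polynomial.eval_mul, Polynomial.eval_C, Polynomial.eval_X,
    Polynomial.eval_comp]
  simp only [size_enc]
  omega

/-- A fold takes polynomial time if each step does and adds only a bounded amount to a quantity `w` that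
bounds the size of the accumulator. -/
theorem foldl_of_growth {f : α → List β} {g : α → σ} {h : α → σ → β → σ} (w : α → σ → ℕ)
    (hf : PolyFun f) (hg : PolyFun g) (hh : PolyFun fun x : α × σ × β => h x.1 x.2.1 x.2.2)
    (hw : ∀ a st, esize st ≤ w a st)
    (h₀ : ∃ q : Polynomial ℕ, ∀ a, w a (g a) ≤ q.eval (esize a))
    (h₁ : ∃ q : Polynomial ℕ, ∀ a st, ∀ b ∈ f a, w a (h a st b) ≤ w a st + q.eval (esize (a, b))) :
    PolyFun (fun a => (f a).foldl (h a) (g a)) := by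
  obtain ⟨q₀, h₀⟩ := h₀
  obtain ⟨q₁, h₁⟩ := h₁
  obtain ⟨qf, hqf⟩ := hf.exists_esize_le
  refine foldl hf hg hh ⟨q₀ + qf * q₁.comp (.X + qf), fun a l hl => ?_⟩
  have key : ∀ (l : List β) (st : σ), (∀ b ∈ l, b ∈ f a) →
      w a (l.foldl (h a) st) ≤ w a st + l.length * q₁.eval (esize a + qf.eval (esize a)) := by
    intro l
    induction l with
    | nil => simp
    | cons b l ih =>
      intro st hb
      have h2 := ih (h a st b) fun x hx => hb x (by simp [hx])
      have hbm := hb b (by simp)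
      have h3 := h₁ a st b hbm
      have h4 := esize_le_of_mem hbm
      have h5 := hqf a
      have h6 := q₁.eval_nat_mono (show esize (a, b) ≤ esize a + qf.eval (esize a) by simp; omega)
      simp only [List.foldl_cons, List.length_cons, Nat.add_mul]
      omega
  have h2 := key l (g a) fun b hb => hl.subset hb
  have h3 := hl.length_le
  have h4 := length_le_esize (f a)
  have h5 := hqf a
  have h6 := Nat.mul_le_mul_right (q₁.eval (esize a + qf.eval (esize a)))
    (show l.length ≤ qf.eval (esize a) by omega)
  have h7 := hw a (l.foldl (h a) (g a))
  have h8 := h₀ a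
  simp only [Polynomial.eval_add, Polynomial.eval_mul, Polynomial.eval_X, Polynomial.eval_comp]
  omega

end PolyFun

/-! ### Lists and counters in polynomial time -/

namespace PolyFun

variable {α β γ δ σ : Type} [Enc α] [Enc β] [Enc γ] [Enc δ] [Enc σ]

theorem reverse {f : α → List β} (hf : PolyFun f) : PolyFun (fun a => (f a).reverse) := by
  have h : PolyFun (fun a => (f a).foldl (fun acc b => b :: acc) []) := by
    refine foldl_of_growth (fun _ st => esize st) hf (const []) (PolyFun.id.snd.snd.cons PolyFun.id.snd.fst)
      (fun _ _ => le_rfl) ⟨1, fun _ => by simp⟩ ⟨.X, fun a st b _ => by simp; omega⟩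
  simpa [List.foldl_flip_cons_eq_append] using h

theorem append {f g : α → List β} (hf : PolyFun f) (hg : PolyFun g) :
    PolyFun (fun a => f a ++ g a) := by
  obtain ⟨q, hq⟩ := hg.exists_esize_le
  have h : PolyFun (fun a => (f a).reverse.foldl (fun acc b => b :: acc) (g a)) := by
    refine foldl_of_growth (fun _ st => esize st) hf.reverse hg
      (PolyFun.id.snd.snd.cons PolyFun.id.snd.fst)
      (fun _ _ => le_rfl) ⟨q, hq⟩ ⟨.X, fun a st b _ => by simp; omega⟩
  simpa [List.foldl_flip_cons_eq_append] using h

theorem filterMap {f : α → List β} {k : α → β → Option γ} (hf : PolyFun f)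
    (hk : PolyFun fun x : α × β => k x.1 x.2) : PolyFun (fun a => (f a).filterMap (k a)) := by
  obtain ⟨q, hq⟩ := hk.exists_esize_le
  have h : PolyFun (fun a => (f a).reverse.foldl
      (fun acc b => (k a b).elim acc fun c => c :: acc) []) := by
    refine foldl_of_growth (h := fun a acc b => (k a b).elim acc fun c => c :: acc)
      (fun _ st => esize st) hf.reverse (const [])
      (optionElim (h := fun (x : α × List γ × β) c => c :: x.2.1)
        (hk.comp (PolyFun.id.fst.pair PolyFun.id.snd.snd)) PolyFun.id.snd.fst
        (PolyFun.id.snd.cons PolyFun.id.fst.snd.fst))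
      (fun _ _ => le_rfl) ⟨1, fun _ => by simp⟩ ⟨q + 1, fun a st b _ => ?_⟩
    have := hq (a, b)
    dsimp only at this ⊢
    cases hkab : k a b with
    | none => simp
    | some c => rw [hkab] at this; simp at this ⊢; omega
  have e : (fun a => (f a).filterMap (k a)) = fun a => (f a).reverse.foldl
      (fun acc b => (k a b).elim acc fun c => c :: acc) [] := by
    funext a
    rw [List.foldl_reverse]
    induction f a with
    | nil => rfl
    | cons b l ih => simp only [List.filterMap_cons, List.foldr_cons, ← ih]; cases k a b <;> rfl
  rwa [e]

theorem map {f : α → List β} {k : α → β → γ} (hf : PolyFun f)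
    (hk : PolyFun fun x : α × β => k x.1 x.2) : PolyFun (fun a => (f a).map (k a)) := by
  simpa [List.filterMap_eq_map] using hf.filterMap (k := fun a b => Option.some (k a b)) hk.some

theorem flatMap {f : α → List β} {k : α → β → List γ} (hf : PolyFun f)
    (hk : PolyFun fun x : α × β => k x.1 x.2) : PolyFun (fun a => (f a).flatMap (k a)) := by
  obtain ⟨q, hq⟩ := hk.exists_esize_le
  have h : PolyFun (fun a => (f a).reverse.foldl (fun acc b => k a b ++ acc) []) := by
    refine foldl_of_growth (fun _ st => esize st) hf.reverse (const [])
      ((hk.comp (PolyFun.id.fst.pair PolyFun.id.snd.snd)).append PolyFun.id.snd.fst)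
      (fun _ _ => le_rfl) ⟨1, fun _ => by simp⟩ ⟨q, fun a st b _ => ?_⟩
    have := hq (a, b)
    have := esize_append (k a b) st
    dsimp only at *
    omega
  have e : (fun a => (f a).flatMap (k a)) = fun a => (f a).reverse.foldl
      (fun acc b => k a b ++ acc) [] := by
    funext a
    rw [List.foldl_reverse]
    induction f a with
    | nil => rfl
    | cons b l ih => simp [← ih]
  rwa [e]

theorem all {f : α → List β} {k : α → β → Bool} (hf : PolyFun f)
    (hk : PolyFun fun x : α × β => k x.1 x.2) : PolyFun (fun a => (f a).all (k a)) := by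
  have h : PolyFun (fun a => (f a).foldl (fun acc b => acc && k a b) true) :=
    foldl_of_growth (fun _ _ => 3) hf (const true)
      (PolyFun.id.snd.fst.and (hk.comp (PolyFun.id.fst.pair PolyFun.id.snd.snd)))
      (fun _ _ => esize_bool_le _) ⟨.C 3, fun _ => by simp⟩ ⟨0, fun _ _ _ _ => by simp⟩
  have e : ∀ a, ∀ (l : List β) (c : Bool), l.foldl (fun acc b => acc && k a b) c = (c && l.all (k a)) := by
    intro a l
    induction l with
    | nil => simp
    | cons b l ih => intro c; simp [ih, Bool.and_assoc]
  simpa [e] using h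

theorem any {f : α → List β} {k : α → β → Bool} (hf : PolyFun f)
    (hk : PolyFun fun x : α × β => k x.1 x.2) : PolyFun (fun a => (f a).any (k a)) := by
  have h := (hf.all (k := fun a b => !k a b) hk.not).not
  simpa [List.not_all_eq_any_not] using h

theorem mem {f : α → β} {g : α → List β} (hf : PolyFun f) (hg : PolyFun g)
    {_ : ∀ a, Decidable (f a ∈ g a)} : PolyFun (fun a => decide (f a ∈ g a)) := by
  classical
  have h := hg.any (k := fun a b => decide (f a = b)) ((hf.comp PolyFun.id.fst).decide_eq PolyFun.id.snd)
  have e : (fun a => decide (f a ∈ g a)) = fun a => (g a).any fun b => decide (f a = b) := by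
    funext a
    rw [Bool.eq_iff_iff]
    simp
  rwa [e]

theorem find? {f : α → List β} {k : α → β → Bool} (hf : PolyFun f)
    (hk : PolyFun fun x : α × β => k x.1 x.2) : PolyFun (fun a => (f a).find? (k a)) := by
  have h : PolyFun (fun a => (f a).foldl (fun acc b => acc.elim
      (if k a b then Option.some b else none) Option.some) none) := by
    refine foldl_of_growth
      (h := fun a acc b => acc.elim (if k a b then Option.some b else none) Option.some)
      (fun _ st => esize st) hf (const none)
      (optionElim (h := fun _ c => Option.some c) PolyFun.id.snd.fst
        ((hk.comp (PolyFun.id.fst.pair PolyFun.id.snd.snd)).ite PolyFun.id.snd.snd.some (const none))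
        PolyFun.id.snd.some)
      (fun _ _ => le_rfl) ⟨1, fun _ => by simp⟩ ⟨.X + 1, fun a st b _ => ?_⟩
    cases st with
    | none => cases k a b <;> simp; omega
    | some c => simp
  have e : ∀ a, ∀ (l : List β) (c : Option β), l.foldl (fun acc b => acc.elim
      (if k a b then Option.some b else none) Option.some) c = c.or (l.find? (k a)) := by
    intro a l
    induction l with
    | nil => simp
    | cons b l ih =>
      intro c
      rw [List.foldl_cons, ih]
      cases c <;> cases h : k a b <;> simp [h]
  simpa [e] using h

/-- One step of the removal of the first copy of `x`: the flag says whether it has been removed. -/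
def eraseStep [DecidableEq β] (x : β) (st : Bool × List β) (b : β) : Bool × List β :=
  if !st.1 && decide (b = x) then (true, st.2) else (st.1, b :: st.2)

theorem erase [BEq β] [LawfulBEq β] {f : α → List β} {g : α → β} (hf : PolyFun f)
    (hg : PolyFun g) : PolyFun (fun a => (f a).erase (g a)) := by
  let : DecidableEq β := instDecidableEqOfLawfulBEq
  have h : PolyFun (fun a => ((f a).foldl (eraseStep (g a)) (false, [])).2.reverse) := by
    refine reverse (snd (foldl_of_growth (h := fun a => eraseStep (g a)) (fun _ st => 4 + esize st.2)
      hf ((const false).pair (const []))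
      (ite (PolyFun.id.snd.fst.fst.not.and (PolyFun.id.snd.snd.decide_eq (hg.comp PolyFun.id.fst)))
        ((const true).pair PolyFun.id.snd.fst.snd)
        (PolyFun.id.snd.fst.fst.pair (PolyFun.id.snd.snd.cons PolyFun.id.snd.fst.snd)))
      (fun _ st => ?_) ⟨.C 5, fun _ => by simp⟩ ⟨.X, fun a st b _ => ?_⟩))
    · obtain ⟨c, l⟩ := st
      have := esize_bool_le c
      simp only [esize_prod]
      omega
    · unfold eraseStep
      split <;> simp; omega
  have e₁ : ∀ (x : β) (l acc : List β), (l.foldl (eraseStep x) (true, acc)).2.reverse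
      = acc.reverse ++ l := by
    intro x l
    induction l with
    | nil => simp
    | cons b l ih => intro acc; simp [eraseStep, ih]
  have e₂ : ∀ (x : β) (l acc : List β), (l.foldl (eraseStep x) (false, acc)).2.reverse
      = acc.reverse ++ l.erase x := by
    intro x l
    induction l with
    | nil => simp
    | cons b l ih =>
      intro acc
      by_cases hb : b = x
      · subst hb; simp [eraseStep, e₁]
      · simp [eraseStep, hb, ih, List.erase_cons_tail]
  simpa [e₂] using h

/-- The binary digits of `n + 1`, lowest digit first, from those of `n`. -/
def incrBits : List Bool → List Bool
  | [] => [true]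
  | false :: l => true :: l
  | true :: l => false :: incrBits l

theorem bits_succ (n : ℕ) : (n + 1).bits = incrBits n.bits := by
  induction n using Nat.binaryRec' with
  | zero => simp [incrBits]
  | bit b n hn ih =>
    rw [Nat.bits_append_bit n b hn]
    cases b with
    | false =>
      rw [show Nat.bit false n + 1 = Nat.bit true n by simp [Nat.bit], Nat.bits_append_bit _ _ (by simp)]
      rfl
    | true =>
      rw [show Nat.bit true n + 1 = Nat.bit false (n + 1) by simp [Nat.bit]; omega,
        Nat.bits_append_bit _ _ (by simp), ih]
      rfl

theorem esize_incrBits_le (l : List Bool) : esize (incrBits l) ≤ esize l + 4 := by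
  have ht : esize true = 3 := rfl
  have hf : esize false = 1 := rfl
  induction l with
  | nil => simp [incrBits, ht]
  | cons b l ih => cases b <;> simp [incrBits, ht, hf] <;> omega

theorem esize_succ_le (n : ℕ) : esize (n + 1) ≤ esize n + 4 := by
  have h : ∀ n : ℕ, esize n = esize n.bits := fun _ => rfl
  rw [h, h, bits_succ]
  exact esize_incrBits_le _

theorem succ {f : α → ℕ} (hf : PolyFun f) : PolyFun (fun a => f a + 1) := by
  have hb : PolyFun Nat.bits := PolyFun.id.of_enc_eq fun _ => rfl
  have hfold : PolyFun (fun l : List Bool => l.foldl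
      (fun (st : Bool × List Bool) b => (st.1 && b, (if st.1 then !b else b) :: st.2)) (true, [])) := by
    refine foldl_of_growth
      (h := fun _ (st : Bool × List Bool) b => (st.1 && b, (if st.1 then !b else b) :: st.2))
      (fun _ st => 4 + esize st.2) PolyFun.id (const (true, []))
      ((PolyFun.id.snd.fst.fst.and PolyFun.id.snd.snd).pair
        ((PolyFun.id.snd.fst.fst.ite PolyFun.id.snd.snd.not PolyFun.id.snd.snd).cons
          PolyFun.id.snd.fst.snd))
      (fun _ st => ?_) ⟨.C 5, fun _ => by simp⟩ ⟨.C 4, fun a st b _ => ?_⟩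
    · obtain ⟨c, l⟩ := st
      have := esize_bool_le c
      simp only [esize_prod]
      omega
    · have := esize_bool_le (if st.1 then !b else b)
      simp at this ⊢
      omega
  have h : PolyFun (fun l : List Bool => if (l.foldl
      (fun (st : Bool × List Bool) b => (st.1 && b, (if st.1 then !b else b) :: st.2)) (true, [])).1
      then (true :: (l.foldl (fun (st : Bool × List Bool) b =>
        (st.1 && b, (if st.1 then !b else b) :: st.2)) (true, [])).2).reverse
      else (l.foldl (fun (st : Bool × List Bool) b =>
        (st.1 && b, (if st.1 then !b else b) :: st.2)) (true, [])).2.reverse) :=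
    hfold.fst.ite ((const true).cons hfold.snd).reverse hfold.snd.reverse
  have e₁ : ∀ l acc : List Bool, l.foldl
      (fun (st : Bool × List Bool) b => (st.1 && b, (if st.1 then !b else b) :: st.2)) (false, acc)
      = (false, l.reverse ++ acc) := by
    intro l
    induction l with
    | nil => simp
    | cons b l ih => intro acc; simpa using ih (b :: acc)
  have e₂ : ∀ l acc : List Bool, (if (l.foldl
      (fun (st : Bool × List Bool) b => (st.1 && b, (if st.1 then !b else b) :: st.2)) (true, acc)).1
      then (true :: (l.foldl (fun (st : Bool × List Bool) b =>
        (st.1 && b, (if st.1 then !b else b) :: st.2)) (true, acc)).2).reverse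
      else (l.foldl (fun (st : Bool × List Bool) b =>
        (st.1 && b, (if st.1 then !b else b) :: st.2)) (true, acc)).2.reverse)
      = acc.reverse ++ incrBits l := by
    intro l
    induction l with
    | nil => simp [incrBits]
    | cons b l ih =>
      intro acc
      cases b with
      | false =>
        have := e₁ l (true :: acc)
        simp only [List.foldl_cons, Bool.and_false, if_true, Bool.not_false, this]
        simp [incrBits]
      | true =>
        have := ih (false :: acc)
        simp only [List.foldl_cons, Bool.and_true, if_true, Bool.not_true]
        rw [this]
        simp [incrBits]
  have h' : PolyFun incrBits := by
    have e : incrBits = _ := funext fun l => ((e₂ l []).trans (List.nil_append _)).symm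
    rw [e]
    exact h
  refine (h'.comp (hb.comp hf)).of_enc_eq fun a => ?_
  rw [← bits_succ]
  rfl

/-- The elements of a list, each with its position. -/
theorem zipIdx {f : α → List β} (hf : PolyFun f) : PolyFun (fun a => (f a).zipIdx) := by
  have h : PolyFun (fun a => ((f a).foldl
      (fun (st : ℕ × List (β × ℕ)) b => (st.1 + 1, (b, st.1) :: st.2)) (0, [])).2.reverse) := by
    refine reverse (snd (foldl (h := fun _ (st : ℕ × List (β × ℕ)) b => (st.1 + 1, (b, st.1) :: st.2))
      hf (const (0, []))
      (PolyFun.id.snd.fst.fst.succ.pair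
        ((PolyFun.id.snd.snd.pair PolyFun.id.snd.fst.fst).cons PolyFun.id.snd.fst.snd)) ?_))
    obtain ⟨q, hq⟩ := hf.exists_esize_le
    have key : ∀ (l : List β) (N n : ℕ) (acc : List (β × ℕ)), esize n + 4 * l.length ≤ N →
        esize (l.foldl (fun (st : ℕ × List (β × ℕ)) b => (st.1 + 1, (b, st.1) :: st.2)) (n, acc))
          ≤ N + l.length * (N + 2) + esize l + esize acc := by
      intro l
      induction l with
      | nil => intro N n acc hN; simp at hN ⊢; omega
      | cons b l ih =>
        intro N n acc hN
        have h₁ := esize_succ_le n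
        simp only [List.length_cons] at hN
        have h₂ := ih N (n + 1) ((b, n) :: acc) (by omega)
        simp only [List.foldl_cons, List.length_cons, esize_cons, esize_prod] at h₂ ⊢
        rw [Nat.add_mul]
        omega
    have hz : esize 0 = 1 := rfl
    refine ⟨1 + .C 4 * q + q * (1 + .C 4 * q + .C 2) + q + 1, fun a l hl => ?_⟩
    have h₁ := key l (1 + 4 * q.eval (esize a)) 0 []
    have h₂ := hq a
    have h₃ := hl.length_le
    have h₄ := length_le_esize (f a)
    obtain ⟨l', hl'⟩ := hl
    have h₅ := esize_append l l'
    rw [hl'] at h₅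
    have h₆ := one_le_esize l'
    have h₇ := Nat.mul_le_mul_right (1 + 4 * q.eval (esize a) + 2)
      (show l.length ≤ q.eval (esize a) by omega)
    specialize h₁ (by omega)
    simp only [Polynomial.eval_add, Polynomial.eval_mul, Polynomial.eval_C, Polynomial.eval_one,
      esize_nil] at h₁ ⊢
    omega
  have e : ∀ (l : List β) (n : ℕ) (acc : List (β × ℕ)), (l.foldl
      (fun (st : ℕ × List (β × ℕ)) b => (st.1 + 1, (b, st.1) :: st.2)) (n, acc)).2.reverse
      = acc.reverse ++ l.zipIdx n := by
    intro l
    induction l with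
    | nil => simp
    | cons b l ih => intro n acc; simp [ih]
  simpa [e] using h

end PolyFun

/-! ### Forests, indegrees and Edmonds' cut condition -/

section Graph

variable {α β : Type}

/-- `IsForest R U T`: the edges `T`, from the last one to the first, form a forest that is directed
away from its roots `R`, and `U` is the set of its vertices. -/
inductive IsForest (R : List α) : List α → List (α × α × β) → Prop
  | nil : IsForest R R []
  | cons {U : List α} {T : List (α × α × β)} {e : α × α × β} :
      IsForest R U T → e.1 ∈ U → e.2.1 ∉ U → IsForest R (e.2.1 :: U) (e :: T)

theorem IsForest.mem_iff {R U : List α} {T : List (α × α × β)} (h : IsForest R U T) (v : α) :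
    v ∈ U ↔ v ∈ R ∨ ∃ e ∈ T, e.2.1 = v := by
  induction h with
  | nil => simp
  | cons _ _ _ ih =>
    simp only [List.mem_cons, ih, exists_eq_or_imp]
    tauto

/-- The number of the edges that enter the set `X`. -/
def inDeg (E : List (α × α × β)) (X : α → Bool) : ℕ := E.countP fun e => !X e.1 && X e.2.1

theorem inDeg_perm {E F : List (α × α × β)} (h : E.Perm F) (X : α → Bool) : inDeg E X = inDeg F X :=
  h.countP_eq _

theorem inDeg_append (E F : List (α × α × β)) (X : α → Bool) :
    inDeg (E ++ F) X = inDeg E X + inDeg F X := List.countP_append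

theorem inDeg_cons (e : α × α × β) (F : List (α × α × β)) (X : α → Bool) :
    inDeg (e :: F) X = inDeg F X + (!X e.1 && X e.2.1).toNat := by
  unfold inDeg
  rw [List.countP_cons]
  cases (!X e.1 && X e.2.1) <;> rfl

theorem inDeg_submodular (E : List (α × α × β)) (A X : α → Bool) :
    inDeg E (fun x => A x && X x) + inDeg E (fun x => A x || X x) ≤ inDeg E A + inDeg E X := by
  induction E with
  | nil => simp [inDeg]
  | cons e E ih =>
    simp only [inDeg_cons]
    have : ((!(A e.1 && X e.1) && (A e.2.1 && X e.2.1)).toNat +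
        (!(A e.1 || X e.1) && (A e.2.1 || X e.2.1)).toNat) ≤
        (!A e.1 && A e.2.1).toNat + (!X e.1 && X e.2.1).toNat := by
      cases A e.1 <;> cases A e.2.1 <;> cases X e.1 <;> cases X e.2.1 <;> simp
    omega

theorem countP_disjoint_supermodular (L : List (List α)) (A X : α → Bool) :
    L.countP (fun U => U.all fun u => !A u) + L.countP (fun U => U.all fun u => !X u) ≤
      L.countP (fun U => U.all fun u => !(A u && X u)) +
        L.countP (fun U => U.all fun u => !(A u || X u)) := by
  induction L with
  | nil => simp
  | cons U L ih =>
    simp only [List.countP_cons]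
    have h₁ : (U.all fun u => !A u) = true → (U.all fun u => !(A u && X u)) = true := by
      simp +contextual
    have h₂ : (U.all fun u => !X u) = true → (U.all fun u => !(A u && X u)) = true := by
      simp +contextual
    have h₃ : (U.all fun u => !A u) = true → (U.all fun u => !X u) = true →
        (U.all fun u => !(A u || X u)) = true := by
      simp +contextual
    split_ifs <;> first | omega | (exfalso; tauto)

/-- Edmonds' condition, for the existence of disjoint branchings with the root sets in `L` that reach
all vertices in `W`: each set `X` that meets `W` is entered by as many edges as there are root sets
disjoint from `X`. -/
def CutCondition (W : List α) (E : List (α × α × β)) (L : List (List α)) : Prop :=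
  ∀ X : α → Bool, (∃ v ∈ W, X v = true) → L.countP (fun U => U.all fun u => !X u) ≤ inDeg E X

/-- The digraph with the edges `E` and, for each root set, a new vertex with an edge to each root. -/
def network (E : List (α × α × β)) (L : List (List α)) :
    List ((List α ⊕ α) × (List α ⊕ α) × Unit) :=
  L.flatMap (fun U => U.map fun u => (.inl U, .inr u, ())) ++ E.map fun e => (.inr e.1, .inr e.2.1, ())

theorem inDeg_network_nil (E : List (α × α × β)) (X : List α ⊕ α → Bool) :
    inDeg (network E []) X = inDeg E fun u => X (.inr u) := by
  simp [network, inDeg, List.countP_map, Function.comp_def]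

theorem inDeg_network_cons (E : List (α × α × β)) (U : List α) (L : List (List α))
    (X : List α ⊕ α → Bool) : inDeg (network E (U :: L)) X =
      (if X (.inl U) then 0 else U.countP fun u => X (.inr u)) + inDeg (network E L) X := by
  simp only [network, List.flatMap_cons, List.append_assoc, inDeg_append _ _ X, Nat.add_right_cancel_iff]
  simp only [inDeg, List.countP_map, Function.comp_def]
  cases X (.inl U) <;> simp

/-! ### Reversing paths -/

variable [DecidableEq α]

/-- One step of the reversal of a path. The state consists of the vertex from which the path has to be
followed backwards, and the edges that have been passed. -/
def revStep (st : α × List (α × α × β)) (e : α × α × β) : α × List (α × α × β) :=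
  if decide (e.2.1 = st.1) then (e.1, (e.2.1, e.1, e.2.2) :: st.2) else (st.1, e :: st.2)

/-- Reversing a path changes the indegree of a set by the difference of the ends of the path. -/
theorem inDeg_revStep (X : α → Bool) (T : List (α × α × β)) : ∀ (c : α) (F : List (α × α × β)),
    inDeg (T.foldl revStep (c, F)).2 X + (X c).toNat =
      inDeg T X + inDeg F X + (X (T.foldl revStep (c, F)).1).toNat := by
  induction T with
  | nil => intro c F; simp [inDeg]
  | cons e T ih =>
    intro c F
    rw [List.foldl_cons, inDeg_cons]
    by_cases he : e.2.1 = c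
    · subst he
      have := ih e.1 ((e.2.1, e.1, e.2.2) :: F)
      rw [inDeg_cons] at this
      simp only [revStep, decide_true, if_true] at this ⊢
      revert this
      cases X e.1 <;> cases X e.2.1 <;> simp <;> omega
    · have := ih c (e :: F)
      rw [inDeg_cons] at this
      simp only [revStep, he, decide_false, Bool.false_eq_true, if_false] at this ⊢
      omega

/-- In a tree, the path that is followed backwards starts in the root. -/
theorem IsForest.revStep_fst {s : α} {U : List α} {T : List (α × α × β)} (h : IsForest [s] U T) :
    ∀ (c : α) (F : List (α × α × β)), c ∈ U → (T.foldl revStep (c, F)).1 = s := by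
  induction h with
  | nil => intro c F hc; simpa using hc
  | @cons U T e _ h₁ _ ih =>
    intro c F hc
    rw [List.foldl_cons]
    by_cases he : e.2.1 = c
    · simp only [revStep, he, decide_true, if_true]
      exact ih _ _ h₁
    · simp only [revStep, he, decide_false, Bool.false_eq_true, if_false]
      exact ih _ _ ((List.mem_cons.1 hc).resolve_left fun h => he h.symm)

/-! ### Growing forests -/

variable [DecidableEq β]

/-- One step of the growth of a forest. The state consists of the set of the vertices that have been
reached, the list of the edges of the forest, and the list of the edges that are left. An edge `(u, v, b)`
goes from `u` to `v` and carries the label `b`; it may be added if it leaves the set of reached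
vertices and if `ok` permits it. -/
def growStep (ok : List α → List (α × α × β) → α × α × β → Bool)
    (st : List α × List (α × α × β) × List (α × α × β)) :
    List α × List (α × α × β) × List (α × α × β) :=
  (st.2.2.find? fun e => decide (e.1 ∈ st.1) && (!decide (e.2.1 ∈ st.1) && ok st.1 st.2.2 e)).elim st
    fun e => (e.2.1 :: st.1, e :: st.2.1, st.2.2.erase e)

/-- Grow a forest from the set `U` of roots, as long as possible. -/
def grow (ok : List α → List (α × α × β) → α × α × β → Bool) (U : List α) (E : List (α × α × β)) :
    List α × List (α × α × β) × List (α × α × β) :=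
  E.foldl (fun st _ => growStep ok st) (U, [], E)

theorem grow_induction {ok : List α → List (α × α × β) → α × α × β → Bool} {U : List α}
    {E : List (α × α × β)} {P : List α → List (α × α × β) → List (α × α × β) → Prop} (h₀ : P U [] E)
    (hstep : ∀ U T F e, P U T F → e ∈ F → e.1 ∈ U → e.2.1 ∉ U → ok U F e = true →
      P (e.2.1 :: U) (e :: T) (F.erase e)) :
    P (grow ok U E).1 (grow ok U E).2.1 (grow ok U E).2.2 := by
  have key : ∀ (l : List (α × α × β)) (st : List α × List (α × α × β) × List (α × α × β)),
      P st.1 st.2.1 st.2.2 → P (l.foldl (fun st _ => growStep ok st) st).1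
        (l.foldl (fun st _ => growStep ok st) st).2.1 (l.foldl (fun st _ => growStep ok st) st).2.2 := by
    intro l
    induction l with
    | nil => exact fun _ h => h
    | cons b l ih =>
      intro st h
      refine ih _ ?_
      change P (growStep ok st).1 (growStep ok st).2.1 (growStep ok st).2.2
      unfold growStep
      cases hf : st.2.2.find? fun e =>
          decide (e.1 ∈ st.1) && (!decide (e.2.1 ∈ st.1) && ok st.1 st.2.2 e) with
      | none => exact h
      | some e =>
        have h₁ := List.find?_some hf
        simp only [Bool.and_eq_true, decide_eq_true_eq, Bool.not_eq_true', decide_eq_false_iff_not] at h₁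
        exact hstep _ _ _ e h (List.mem_of_find?_eq_some hf) h₁.1 h₁.2.1 h₁.2.2
  exact key E _ h₀

/-- There are enough steps: in the end, no edge can be added. -/
theorem grow_stuck (ok : List α → List (α × α × β) → α × α × β → Bool) (U : List α)
    (E : List (α × α × β)) : ∀ e ∈ (grow ok U E).2.2, e.1 ∈ (grow ok U E).1 →
      e.2.1 ∉ (grow ok U E).1 → ¬ ok (grow ok U E).1 (grow ok U E).2.2 e = true := by
  let sel : List α × List (α × α × β) × List (α × α × β) → Option (α × α × β) := fun st =>
    st.2.2.find? fun e => decide (e.1 ∈ st.1) && (!decide (e.2.1 ∈ st.1) && ok st.1 st.2.2 e)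
  have key : ∀ (l : List (α × α × β)) (st : List α × List (α × α × β) × List (α × α × β)),
      sel (l.foldl (fun st _ => growStep ok st) st) = none ∨
        (l.foldl (fun st _ => growStep ok st) st).2.2.length + l.length ≤ st.2.2.length := by
    intro l
    induction l with
    | nil => exact fun _ => .inr le_rfl
    | cons b l ih =>
      intro st
      rcases ih (growStep ok st) with h | h
      · exact .inl h
      cases hf : sel st with
      | none =>
        have hst : growStep ok st = st := by
          change (sel st).elim _ _ = _
          rw [hf]; rfl
        have hall : ∀ l : List (α × α × β), l.foldl (fun st _ => growStep ok st) st = st := by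
          intro l
          induction l with
          | nil => rfl
          | cons b l ih => rw [List.foldl_cons, hst, ih]
        rw [hall]
        exact .inl hf
      | some e =>
        have hm := List.mem_of_find?_eq_some hf
        have hst : growStep ok st = (e.2.1 :: st.1, e :: st.2.1, st.2.2.erase e) := by
          change (sel st).elim _ _ = _
          rw [hf]; rfl
        have h₁ := List.length_erase_of_mem hm
        have h₂ := List.length_pos_of_mem hm
        rw [hst] at h
        simp only [List.foldl_cons, List.length_cons, hst] at h ⊢
        omega
  intro e he h₁ h₂ h₃
  rcases key E (U, [], E) with h | h
  · have := List.find?_eq_none.1 h e he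
    simp only [Bool.and_eq_true, decide_eq_true_eq, Bool.not_eq_true', decide_eq_false_iff_not] at this
    exact this ⟨h₁, h₂, h₃⟩
  · have := List.length_pos_of_mem he
    change (grow ok U E).2.2.length + _ ≤ _ at h
    simp only at h
    omega

theorem grow_perm (ok : List α → List (α × α × β) → α × α × β → Bool) (U : List α)
    (E : List (α × α × β)) : ((grow ok U E).2.1 ++ (grow ok U E).2.2).Perm E := by
  refine grow_induction (P := fun _ T F => (T ++ F).Perm E) (by simp) fun U T F e h he _ _ _ => ?_
  refine .trans ?_ h
  rw [List.cons_append]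
  exact List.perm_middle.symm.trans ((List.perm_cons_erase he).symm.append_left T)

theorem grow_isForest (ok : List α → List (α × α × β) → α × α × β → Bool) (U : List α)
    (E : List (α × α × β)) : IsForest U (grow ok U E).1 (grow ok U E).2.1 :=
  grow_induction (P := fun V T _ => IsForest U V T) .nil fun _ _ _ _ h _ h₁ h₂ _ => .cons h h₁ h₂

/-! ### Testing the cut condition -/

/-- Look for a path from `s` to `v`, and reverse it. The flag says whether all paths have been found. -/
def augment (v : α) (st : Bool × List (α × α × β)) (s : α) : Bool × List (α × α × β) :=
  (st.1 && decide (((grow (fun _ _ _ => true) [s] st.2).2.1.foldl revStep (v, [])).1 = s),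
    ((grow (fun _ _ _ => true) [s] st.2).2.1.foldl revStep (v, [])).2 ++
      (grow (fun _ _ _ => true) [s] st.2).2.2)

/-- Are there edge-disjoint paths to `v` from the members of the list `S`? -/
def flowTest (v : α) (E : List (α × α × β)) (S : List α) : Bool :=
  (S.foldl (augment v) (true, E)).1

/-- Menger's theorem. Reversing a path from `s` to `v` lowers the indegree of each set that contains `v`
by one if it does not contain `s`, and preserves it otherwise; this is how the number of the members
of the list outside of the set changes if `s` is dropped. If there is no path from `s` to `v`, then no edge
enters the set of the vertices that cannot be reached from `s`. -/
theorem flowTest_iff (v : α) (S : List α) : ∀ E : List (α × α × β),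
    flowTest v E S = true ↔ ∀ X : α → Bool, X v = true → S.countP (fun s => !X s) ≤ inDeg E X := by
  have hfalse : ∀ (S : List α) (E : List (α × α × β)), (S.foldl (augment v) (false, E)).1 = false := by
    intro S
    induction S with
    | nil => exact fun _ => rfl
    | cons s S ih => intro E; rw [List.foldl_cons]; exact ih _
  induction S with
  | nil => simp [flowTest]
  | cons s S ih =>
    intro E
    set g := grow (fun _ _ _ => true) [s] E with hg
    have hforest : IsForest [s] g.1 g.2.1 := grow_isForest _ _ _
    have hperm : (g.2.1 ++ g.2.2).Perm E := grow_perm _ _ _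
    have hstep : augment v (true, E) s = (decide ((g.2.1.foldl revStep (v, [])).1 = s),
        (g.2.1.foldl revStep (v, [])).2 ++ g.2.2) := by simp [augment, hg]
    unfold flowTest
    rw [List.foldl_cons, hstep]
    by_cases hs : (g.2.1.foldl revStep (v, [])).1 = s
    · simp only [hs, decide_true]
      refine (ih _).trans (forall_congr' fun X => imp_congr_right fun hX => ?_)
      have h₁ := inDeg_revStep X g.2.1 v []
      have h₂ := inDeg_append g.2.1 g.2.2 X
      have h₃ : inDeg ([] : List (α × α × β)) X = 0 := rfl
      rw [inDeg_perm hperm] at h₂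
      rw [hs, hX, h₃, Bool.toNat_true] at h₁
      rw [inDeg_append, List.countP_cons]
      cases hXs : X s <;> simp [hXs] at h₁ ⊢ <;> omega
    · simp only [hs, decide_false, hfalse, Bool.false_eq_true, false_iff, not_forall]
      have hv : v ∉ g.1 := fun h => hs (hforest.revStep_fst v [] h)
      refine ⟨fun x => !decide (x ∈ g.1), by simpa using hv, ?_⟩
      have h₀ : inDeg E (fun x => !decide (x ∈ g.1)) = 0 := by
        rw [← inDeg_perm hperm]
        refine List.countP_eq_zero.2 fun e he => ?_
        simp only [Bool.not_not, Bool.and_eq_true, decide_eq_true_eq, Bool.not_eq_true',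
          decide_eq_false_iff_not, not_and, not_not]
        intro h₁
        rcases List.mem_append.1 he with h | h
        · exact (hforest.mem_iff _).2 (.inr ⟨e, h, rfl⟩)
        · by_contra h₂
          exact grow_stuck (fun _ _ _ => true) [s] E e h h₁ h₂ rfl
      have h₁ : s ∈ g.1 := (hforest.mem_iff s).2 (.inl (by simp))
      rw [h₀, List.countP_cons]
      simp [h₁]

/-- The cut condition as an algorithm. -/
def cutTest (W : List α) (E : List (α × α × β)) (L : List (List α)) : Bool :=
  W.all fun v => flowTest (.inr v) (network E L) (L.map .inl)

theorem cutTest_iff {γ : Type} {W : List α} {E : List (α × α × γ)} {L : List (List α)} :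
    cutTest W E L = true ↔ CutCondition W E L := by
  simp only [cutTest, List.all_eq_true, flowTest_iff, List.countP_map, Function.comp_def]
  constructor
  · rintro h X ⟨v, hv, hX⟩
    refine le_trans ?_ ((h v hv (Sum.elim (fun U => U.any X) X) hX).trans ?_)
    · refine List.countP_mono_left fun U _ hU => ?_
      simpa [List.all_eq_not_any_not] using hU
    · clear h
      induction L with
      | nil => rw [inDeg_network_nil]; rfl
      | cons U L ih =>
        rw [inDeg_network_cons]
        refine (Nat.add_le_add_left ih _).trans ?_
        cases hU : U.any X with
        | true => simp [hU]
        | false =>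
          have : U.countP X = 0 := List.countP_eq_zero.2 fun u hu => by
            simpa using List.any_eq_false.1 hU u hu
          simp [hU, this]
  · intro h v hv X hX
    have h₁ := h (fun u => X (.inr u)) ⟨v, hv, hX⟩
    suffices h₂ : L.countP (fun U => !X (.inl U)) + inDeg E (fun u => X (.inr u)) ≤
        inDeg (network E L) X + L.countP (fun U => U.all fun u => !X (.inr u)) by omega
    clear h h₁
    induction L with
    | nil => simp [inDeg_network_nil]
    | cons U L ih =>
      rw [inDeg_network_cons, List.countP_cons, List.countP_cons]
      cases hU : X (.inl U) with
      | true => simp; omega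
      | false =>
        cases hUX : U.all fun u => !X (.inr u) with
        | true => simp; omega
        | false =>
          have : 0 < U.countP fun u => X (.inr u) := List.countP_pos_iff.2 (by
            simpa using hUX)
          simp; omega

/-! ### Edmonds' theorem on disjoint branchings -/

/-- Lovász's lemma: as long as the first branching does not reach all vertices, it can be enlarged by
an edge such that the cut condition continues to hold for the remaining edges. -/
theorem CutCondition.exists_edge {W : List α} {E : List (α × α × β)} {U : List α} {L : List (List α)}
    (hE : ∀ e ∈ E, e.1 ∈ W ∧ e.2.1 ∈ W) (hcut : CutCondition W E (U :: L)) (hW : ∃ v ∈ W, v ∉ U) :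
    ∃ e ∈ E, e.1 ∈ U ∧ e.2.1 ∉ U ∧ CutCondition W (E.erase e) ((e.2.1 :: U) :: L) := by
  set p : (α → Bool) → ℕ := fun X => L.countP fun U => U.all fun u => !X u with hp
  have hle : ∀ X : α → Bool, (∃ v ∈ W, X v = true) → p X ≤ inDeg E X := fun X hX => by
    have := hcut X hX
    rw [List.countP_cons] at this
    simp only [hp]
    omega
  have hlt : ∀ X : α → Bool, (∃ v ∈ W, X v = true) → (∀ u ∈ U, X u = false) →
      p X + 1 ≤ inDeg E X := fun X hX hU => by
    have := hcut X hX
    rw [List.countP_cons, if_pos (by simpa using hU)] at this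
    exact this
  -- The tight sets that meet both `U` and its complement; the set of all vertices is one of them.
  set F : Set (α → Bool) := {A | (∃ u ∈ U, A u = true) ∧ (∃ v ∈ W, v ∉ U ∧ A v = true) ∧
    inDeg E A ≤ p A} with hF
  have hne : F.Nonempty := by
    obtain ⟨v, hv, hvU⟩ := hW
    have h₀ : inDeg E (fun _ => true) = 0 := by simp [inDeg]
    refine ⟨fun _ => true, ?_, ⟨v, hv, hvU, rfl⟩, by omega⟩
    by_contra! h
    have := hlt (fun _ => true) ⟨v, hv, rfl⟩ fun u hu => by simpa using h u hu
    omega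
  obtain ⟨A, hA, hmin⟩ := (measure fun A : α → Bool => (W.toFinset.filter fun x => A x).card).wf.has_min
    F hne
  obtain ⟨⟨a, haU, ha⟩, ⟨b, hb, hbU, hbA⟩, htight⟩ := hA
  have hB : p A + 1 ≤ inDeg E fun x => A x && !decide (x ∈ U) := by
    refine le_trans (Nat.add_le_add_right ?_ 1) (hlt (fun x => A x && !decide (x ∈ U))
      ⟨b, hb, by simp [hbA, hbU]⟩ (by simp +contextual))
    refine List.countP_mono_left fun U' _ hU' => ?_
    simp only [List.all_eq_true, Bool.not_eq_true'] at hU' ⊢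
    intro x hx
    simp [hU' x hx]
  obtain ⟨e, he, he₁, he₂⟩ : ∃ e ∈ E, (!(A e.1 && !decide (e.1 ∈ U)) &&
      (A e.2.1 && !decide (e.2.1 ∈ U))) = true ∧ ¬ (!A e.1 && A e.2.1) = true := by
    by_contra! h
    have := List.countP_mono_left h
    simp only [inDeg] at hB htight
    omega
  simp only [Bool.and_eq_true, Bool.not_eq_true', Bool.and_eq_false_iff, Bool.not_eq_false',
    decide_eq_true_eq, decide_eq_false_iff_not, not_and, Bool.not_eq_true] at he₁ he₂
  obtain ⟨h₁, h₂, h₃⟩ := he₁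
  have hA₁ : A e.1 = true := by
    by_contra h
    rw [he₂ (by simpa using h)] at h₂
    exact absurd h₂ (by simp)
  have hU₁ : e.1 ∈ U := h₁.resolve_left (by simp [hA₁])
  refine ⟨e, he, hU₁, h₃, fun X hX => ?_⟩
  have herase := inDeg_perm (List.perm_cons_erase he) X
  rw [inDeg_cons] at herase
  rw [List.countP_cons]
  change p X + _ ≤ _
  by_cases hent : (!X e.1 && X e.2.1) = true
  · rw [hent, Bool.toNat_true] at herase
    simp only [Bool.and_eq_true, Bool.not_eq_true'] at hent
    rw [if_neg (by simp [hent.2])]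
    by_cases hdis : ∀ u ∈ U, X u = false
    · have := hlt X hX hdis
      omega
    by_contra hbad
    -- Now `X` is tight as well, and so is its intersection with `A`, against the choice of `A`.
    have hC := hle (fun x => A x && X x) ⟨e.2.1, (hE e he).2, by simp [h₂, hent.2]⟩
    have hD := hle (fun x => A x || X x) ⟨e.2.1, (hE e he).2, by simp [h₂]⟩
    have hsub := inDeg_submodular E A X
    have hsup := countP_disjoint_supermodular L A X
    simp only [hp] at hbad htight hC hD hsub hsup hlt herase
    have hCU : ∃ u ∈ U, (A u && X u) = true := by
      by_contra! h
      have := hlt (fun x => A x && X x) ⟨e.2.1, (hE e he).2, by simp [h₂, hent.2]⟩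
        fun u hu => by simpa using h u hu
      omega
    refine hmin (fun x => A x && X x) ⟨hCU, ⟨e.2.1, (hE e he).2, h₃, by simp [h₂, hent.2]⟩, ?_⟩ ?_
    · simp only [hp]
      omega
    · refine Finset.card_lt_card ⟨fun x hx => ?_, fun h => ?_⟩
      · simp only [Finset.mem_filter, Bool.and_eq_true] at hx ⊢
        exact ⟨hx.1, hx.2.1⟩
      · have := @h e.1 (by simp [hA₁, (hE e he).1])
        simp [hent.1] at this
  · rw [Bool.not_eq_true] at hent
    rw [hent, Bool.toNat_false] at herase
    have h := hcut X hX
    rw [List.countP_cons] at h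
    change p X + _ ≤ _ at h
    refine le_trans (Nat.add_le_add_left ?_ _) (h.trans (by omega))
    simp only [List.all_cons, Bool.and_eq_true]
    split_ifs <;> simp_all

/-- Grow a branching with root set `R` such that the cut condition continues to hold for the other root
sets `L` and the remaining edges. -/
def growBranching (W : List α) (L : List (List α)) (R : List α) (E : List (α × α × β)) :
    List α × List (α × α × β) × List (α × α × β) :=
  grow (fun U F e => cutTest W (F.erase e) ((e.2.1 :: U) :: L)) R E

theorem growBranching_spec {W : List α} {E : List (α × α × β)} {R : List α} {L : List (List α)}
    (hE : ∀ e ∈ E, e.1 ∈ W ∧ e.2.1 ∈ W) (hcut : CutCondition W E (R :: L)) :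
    (∀ v ∈ W, v ∈ (growBranching W L R E).1) ∧ CutCondition W (growBranching W L R E).2.2 L := by
  have h : CutCondition W (growBranching W L R E).2.2 ((growBranching W L R E).1 :: L) :=
    grow_induction (P := fun U _ F => CutCondition W F (U :: L)) hcut
      fun _ _ _ _ _ _ _ _ h => cutTest_iff.1 h
  refine ⟨?_, fun X hX => le_trans ?_ (h X hX)⟩
  · by_contra! hW
    obtain ⟨e, he, h₁, h₂, h₃⟩ := h.exists_edge
      (fun e he => hE e ((grow_perm _ R E).subset (List.mem_append_right _ he))) hW
    exact grow_stuck _ _ _ e he h₁ h₂ (cutTest_iff.2 h₃)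
  · rw [List.countP_cons]
    omega

/-- One step of the search for disjoint branchings. The state consists of a flag that says whether all
branchings reach all vertices, the list of the root sets that are to be dealt with, the
remaining edges, and the branchings that have been constructed. -/
def packStep (W : List α) (st : Bool × List (List α) × List (α × α × β) × List (List (α × α × β)))
    (R : List α) : Bool × List (List α) × List (α × α × β) × List (List (α × α × β)) :=
  (st.1 && W.all (fun v => decide (v ∈ (growBranching W st.2.1.tail R st.2.2.1).1)), st.2.1.tail,
    (growBranching W st.2.1.tail R st.2.2.1).2.2,
    (growBranching W st.2.1.tail R st.2.2.1).2.1 :: st.2.2.2)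

/-- The search for disjoint branchings with the root sets in `L` that reach all vertices in `W`. -/
def pack (W : List α) (E : List (α × α × β)) (L : List (List α)) : Option (List (List (α × α × β))) :=
  if (L.foldl (packStep W) (true, L, E, [])).1 then
    some (L.foldl (packStep W) (true, L, E, [])).2.2.2.reverse
  else none

theorem foldl_packStep_sound (W : List α) (L : List (List α)) :
    ∀ (c : Bool) (E : List (α × α × β)) (out : List (List (α × α × β))),
      (L.foldl (packStep W) (c, L, E, out)).1 = true → c = true ∧ ∃ Ts : List (List (α × α × β)),
        (L.foldl (packStep W) (c, L, E, out)).2.2.2 = Ts.reverse ++ out ∧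
        List.Forall₂ (fun R T => ∃ U, IsForest R U T ∧ ∀ v ∈ W, v ∈ U) L Ts ∧
        ∃ F, (Ts.flatten ++ F).Perm E := by
  induction L with
  | nil => exact fun c E out h => ⟨h, [], rfl, .nil, E, .refl E⟩
  | cons R L ih =>
    intro c E out h
    have hperm : ((growBranching W L R E).2.1 ++ (growBranching W L R E).2.2).Perm E :=
      grow_perm _ _ _
    have hstep : packStep W (c, R :: L, E, out) R = (c && W.all (fun v =>
        decide (v ∈ (growBranching W L R E).1)), L, (growBranching W L R E).2.2,
        (growBranching W L R E).2.1 :: out) := rfl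
    rw [List.foldl_cons, hstep] at h ⊢
    obtain ⟨h₁, Ts, h₂, h₃, F, h₄⟩ := ih _ _ _ h
    simp only [Bool.and_eq_true, List.all_eq_true, decide_eq_true_eq] at h₁
    refine ⟨h₁.1, (growBranching W L R E).2.1 :: Ts, by rw [h₂]; simp,
      .cons ⟨_, grow_isForest _ _ _, h₁.2⟩ h₃, F, ?_⟩
    rw [List.flatten_cons, List.append_assoc]
    exact (h₄.append_left _).trans hperm

theorem pack_sound {W : List α} {E : List (α × α × β)} {L : List (List α)}
    {Ts : List (List (α × α × β))} (h : pack W E L = some Ts) :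
    List.Forall₂ (fun R T => ∃ U, IsForest R U T ∧ ∀ v ∈ W, v ∈ U) L Ts ∧
      ∃ F, (Ts.flatten ++ F).Perm E := by
  unfold pack at h
  split_ifs at h with h₁
  obtain ⟨-, Ts', h₂, h₃⟩ := foldl_packStep_sound W L true E [] h₁
  rw [h₂] at h
  obtain rfl : Ts' = Ts := by simpa using h
  exact h₃

/-- Edmonds' theorem: the cut condition suffices. -/
theorem pack_ne_none {W : List α} {E : List (α × α × β)} {L : List (List α)}
    (hE : ∀ e ∈ E, e.1 ∈ W ∧ e.2.1 ∈ W) (hcut : CutCondition W E L) : pack W E L ≠ none := by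
  suffices h : ∀ (E : List (α × α × β)) (out : List (List (α × α × β))),
      (∀ e ∈ E, e.1 ∈ W ∧ e.2.1 ∈ W) → CutCondition W E L →
      (L.foldl (packStep W) (true, L, E, out)).1 = true by
    simp [pack, h E [] hE hcut]
  clear hE hcut E
  induction L with
  | nil => exact fun _ _ _ _ => rfl
  | cons R L ih =>
    intro E out hE hcut
    obtain ⟨h₁, h₂⟩ := growBranching_spec hE hcut
    have hall : W.all (fun v => decide (v ∈ (growBranching W L R E).1)) = true :=
      List.all_eq_true.2 fun v hv => decide_eq_true (h₁ v hv)
    have hstep : packStep W (true, R :: L, E, out) R = (true, L, (growBranching W L R E).2.2,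
        (growBranching W L R E).2.1 :: out) := by
      unfold packStep
      rw [List.tail_cons, hall]
      rfl
    rw [List.foldl_cons, hstep]
    exact ih _ _ (fun e he => hE e ((grow_perm _ R E).subset (List.mem_append_right _ he))) h₂

end Graph

/-! ### The search for disjoint branchings takes polynomial time -/

section

variable {α β γ : Type} [Enc α] [Enc β] [Enc γ] [DecidableEq α]

theorem esize_foldl_revStep (T : List (α × α × β)) : ∀ (c : α) (F : List (α × α × β)),
    esize (T.foldl revStep (c, F)).2 + 1 = esize T + esize F := by
  induction T with
  | nil => intro c F; simp; omega
  | cons e T ih =>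
    intro c F
    obtain ⟨u, v, b⟩ := e
    rw [List.foldl_cons]
    by_cases h : v = c
    · have := ih u ((v, u, b) :: F)
      simp only [revStep, h, decide_true, if_true, esize_cons, esize_prod] at this ⊢
      omega
    · have := ih c ((u, v, b) :: F)
      simp only [revStep, h, decide_false, Bool.false_eq_true, if_false, esize_cons, esize_prod] at this ⊢
      omega

theorem PolyFun.foldl_revStep {T : γ → List (α × α × β)} {v : γ → α} (hT : PolyFun T) (hv : PolyFun v) :
    PolyFun (fun a => (T a).foldl revStep (v a, [])) := by
  obtain ⟨q, hq⟩ := hv.exists_esize_le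
  refine PolyFun.foldl_of_growth (h := fun _ => revStep) (fun _ st => 1 + esize st.1 + esize st.2) hT
    (hv.pair (PolyFun.const [])) ?_ (fun _ _ => le_rfl) ⟨.C 2 + q, fun a => ?_⟩ ⟨.C 2 * .X, fun a st b _ => ?_⟩
  · exact (PolyFun.id.snd.snd.snd.fst.decide_eq PolyFun.id.snd.fst.fst).ite
      (PolyFun.id.snd.snd.fst.pair ((PolyFun.id.snd.snd.snd.fst.pair (PolyFun.id.snd.snd.fst.pair
        PolyFun.id.snd.snd.snd.snd)).cons PolyFun.id.snd.fst.snd))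
      (PolyFun.id.snd.fst.fst.pair (PolyFun.id.snd.snd.cons PolyFun.id.snd.fst.snd))
  · have := hq a
    simp
    omega
  · obtain ⟨u, w, b⟩ := b
    unfold revStep
    split <;> simp <;> omega

variable [DecidableEq β]

theorem esize_grow (ok : List α → List (α × α × β) → α × α × β → Bool) (U : List α)
    (E : List (α × α × β)) : esize (grow ok U E).2.1 + esize (grow ok U E).2.2 = esize E + 1 := by
  rw [← esize_append, esize_perm (grow_perm ok U E)]

namespace PolyFun

theorem grow {ok : γ → List α → List (α × α × β) → α × α × β → Bool} {U : γ → List α}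
    {E : γ → List (α × α × β)}
    (hok : PolyFun fun x : γ × List α × List (α × α × β) × α × α × β => ok x.1 x.2.1 x.2.2.1 x.2.2.2)
    (hU : PolyFun U) (hE : PolyFun E) : PolyFun (fun a => grow (ok a) (U a) (E a)) := by
  obtain ⟨qU, hqU⟩ := hU.exists_esize_le
  obtain ⟨qE, hqE⟩ := hE.exists_esize_le
  -- An edge moves from the third component of the state to the second one, and its head is copied.
  refine foldl_of_growth (h := fun a st _ => growStep (ok a) st)
    (fun _ st => 2 + esize st.1 + esize st.2.1 + 2 * esize st.2.2) hE (hU.pair ((const []).pair hE))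
    ?_ (fun _ st => ?_) ⟨.C 3 + qU + .C 2 * qE, fun a => ?_⟩ ⟨0, fun a st _ _ => ?_⟩
  · refine optionElim (h := fun (x : γ × (List α × List (α × α × β) × List (α × α × β)) × α × α × β)
      e => (e.2.1 :: x.2.1.1, e :: x.2.1.2.1, x.2.1.2.2.erase e)) (find? PolyFun.id.snd.fst.snd.snd
      (k := fun x e => decide (e.1 ∈ x.2.1.1) && (!decide (e.2.1 ∈ x.2.1.1) &&
        ok x.1 x.2.1.1 x.2.1.2.2 e)) ?_) PolyFun.id.snd.fst ?_
    · exact (PolyFun.id.snd.fst.mem PolyFun.id.fst.snd.fst.fst).and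
        ((PolyFun.id.snd.snd.fst.mem PolyFun.id.fst.snd.fst.fst).not.and
          (hok.comp (PolyFun.id.fst.fst.pair (PolyFun.id.fst.snd.fst.fst.pair
            (PolyFun.id.fst.snd.fst.snd.snd.pair PolyFun.id.snd)))))
    · exact (PolyFun.id.snd.snd.fst.cons PolyFun.id.fst.snd.fst.fst).pair
        ((PolyFun.id.snd.cons PolyFun.id.fst.snd.fst.snd.fst).pair
          (PolyFun.id.fst.snd.fst.snd.snd.erase PolyFun.id.snd))
  · obtain ⟨U, T, F⟩ := st
    simp only [esize_prod]
    omega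
  · have := hqU a
    have := hqE a
    simp
    omega
  · obtain ⟨U, T, F⟩ := st
    unfold growStep
    cases hf : F.find? fun e => decide (e.1 ∈ U) && (!decide (e.2.1 ∈ U) && ok a U F e) with
    | none => simp
    | some e =>
      have := esize_perm (List.perm_cons_erase (List.mem_of_find?_eq_some hf))
      have h : esize e = 1 + esize e.1 + (1 + esize e.2.1 + esize e.2.2) := rfl
      simp only [esize_cons] at this
      simp
      omega

theorem flowTest {v : γ → α} {E : γ → List (α × α × β)} {S : γ → List α} (hv : PolyFun v)
    (hE : PolyFun E) (hS : PolyFun S) : PolyFun (fun a => flowTest (v a) (E a) (S a)) := by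
  obtain ⟨q, hq⟩ := hE.exists_esize_le
  refine fst (foldl_of_growth (h := fun a => augment (v a)) (fun _ st => 4 + esize st.2) hS
    ((const true).pair hE) ?_ (fun _ st => ?_) ⟨.C 4 + q, fun a => ?_⟩ ⟨0, fun a st s _ => ?_⟩)
  · have hg : PolyFun fun x : γ × (Bool × List (α × α × β)) × α =>
        _root_.grow (fun _ _ _ => true) [x.2.2] x.2.1.2 :=
      grow (ok := fun _ _ _ _ => true) (const true) (PolyFun.id.snd.snd.cons (const []))
        PolyFun.id.snd.fst.snd
    have hr := foldl_revStep hg.snd.fst (hv.comp PolyFun.id.fst)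
    exact (PolyFun.id.snd.fst.fst.and (hr.fst.decide_eq PolyFun.id.snd.snd)).pair
      (hr.snd.append hg.snd.snd)
  · obtain ⟨c, F⟩ := st
    have := esize_bool_le c
    simp only [esize_prod]
    omega
  · have := hq a
    simp
    omega
  · have h₁ := esize_grow (fun _ _ _ => true) [s] st.2
    have h₂ := esize_foldl_revStep (_root_.grow (fun _ _ _ => true) [s] st.2).2.1 (v a) []
    have h₃ := esize_append
      ((_root_.grow (fun _ _ _ => true) [s] st.2).2.1.foldl revStep (v a, [])).2
      (_root_.grow (fun _ _ _ => true) [s] st.2).2.2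
    simp only [augment, Polynomial.eval_zero, esize_nil] at *
    omega

theorem cutTest {δ : Type} [Enc δ] {W : γ → List α} {E : γ → List (α × α × δ)} {L : γ → List (List α)}
    (hW : PolyFun W) (hE : PolyFun E) (hL : PolyFun L) :
    PolyFun (fun a => cutTest (W a) (E a) (L a)) := by
  refine all hW (k := fun a v => _root_.flowTest (.inr v) (network (E a) (L a)) ((L a).map .inl))
    (flowTest PolyFun.id.snd.inr (.append (flatMap (hL.comp PolyFun.id.fst)
      (k := fun _ U => U.map fun u => (Sum.inl U, Sum.inr u, ())) ?_)
      (map (hE.comp PolyFun.id.fst) (k := fun _ e => (Sum.inr e.1, Sum.inr e.2.1, ())) ?_))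
      (map (hL.comp PolyFun.id.fst) (k := fun _ U => Sum.inl U) PolyFun.id.snd.inl))
  · exact map PolyFun.id.snd 
      (k := fun (x : (γ × α) × List α) u => (Sum.inl x.2, Sum.inr u, ()))
      (PolyFun.id.fst.snd.inl.pair (PolyFun.id.snd.inr.pair (const ())))
  · exact PolyFun.id.snd.fst.inr.pair (PolyFun.id.snd.snd.fst.inr.pair (const ()))

theorem growBranching {W : γ → List α} {L : γ → List (List α)} {R : γ → List α}
    {E : γ → List (α × α × β)} (hW : PolyFun W) (hL : PolyFun L) (hR : PolyFun R) (hE : PolyFun E) :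
    PolyFun (fun a => growBranching (W a) (L a) (R a) (E a)) :=
  grow (ok := fun a U F e => _root_.cutTest (W a) (F.erase e) ((e.2.1 :: U) :: L a))
    (cutTest (hW.comp PolyFun.id.fst) (PolyFun.id.snd.snd.fst.erase PolyFun.id.snd.snd.snd)
      ((PolyFun.id.snd.snd.snd.snd.fst.cons PolyFun.id.snd.fst).cons (hL.comp PolyFun.id.fst))) hR hE

theorem packStep {W : γ → List α}
    {st : γ → Bool × List (List α) × List (α × α × β) × List (List (α × α × β))} {R : γ → List α}
    (hW : PolyFun W) (hst : PolyFun st) (hR : PolyFun R) :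
    PolyFun (fun a => packStep (W a) (st a) (R a)) := by
  have hg := growBranching hW hst.snd.fst.listTail hR hst.snd.snd.fst
  have hg' := comp hg.fst (PolyFun.id (α := γ × α)).fst
  have hall := all hW (k := fun a v =>
    decide (v ∈ (_root_.growBranching (W a) (st a).2.1.tail (R a) (st a).2.2.1).1))
    (mem PolyFun.id.snd hg')
  exact (hst.fst.and hall).pair (hst.snd.fst.listTail.pair
    (hg.snd.snd.pair (hg.snd.fst.cons hst.snd.snd.snd)))

theorem pack {W : γ → List α} {E : γ → List (α × α × β)} {L : γ → List (List α)}
    (hW : PolyFun W) (hE : PolyFun E) (hL : PolyFun L) : PolyFun (fun a => pack (W a) (E a) (L a)) := by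
  obtain ⟨qE, hqE⟩ := hE.exists_esize_le
  obtain ⟨qL, hqL⟩ := hL.exists_esize_le
  have h : PolyFun fun a => (L a).foldl (_root_.packStep (W a)) (true, L a, E a, []) := by
    refine foldl_of_growth (h := fun a => _root_.packStep (W a))
      (fun _ st => 6 + esize st.2.1 + esize st.2.2.1 + esize st.2.2.2) hL
      ((const true).pair (hL.pair (hE.pair (const []))))
      (packStep (hW.comp PolyFun.id.fst) PolyFun.id.snd.fst PolyFun.id.snd.snd) (fun _ st => ?_)
      ⟨.C 7 + qE + qL, fun a => ?_⟩ ⟨.C 2, fun a st R _ => ?_⟩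
    · obtain ⟨c, L, F, out⟩ := st
      have := esize_bool_le c
      simp only [esize_prod]
      omega
    · have := hqE a
      have := hqL a
      simp
      omega
    · have h₁ : esize st.2.1.tail ≤ esize st.2.1 := by cases st.2.1 <;> simp
      have h₂ := esize_grow
        (fun U F e => _root_.cutTest (W a) (F.erase e) ((e.2.1 :: U) :: st.2.1.tail)) R st.2.2.1
      change esize (_root_.growBranching (W a) st.2.1.tail R st.2.2.1).2.1 +
        esize (_root_.growBranching (W a) st.2.1.tail R st.2.2.1).2.2 = _ at h₂
      simp only [_root_.packStep, esize_cons, Polynomial.eval_C]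
      omega
  exact h.fst.ite h.snd.snd.snd.reverse.some (const none)

end PolyFun

end

/-! ### Temporal walks -/

namespace TemporalSubdigraph

variable {V E : Type} {G : TemporalDigraph V E} {B : TemporalSubdigraph G} {r : V × ℕ}
  {w : List (WalkItem V E)}

theorem IsWalk.single {z : V × ℕ} (h : z.2 ∈ B.γ z.1) : B.IsWalk z z [.vertex z.1 z.2] where
  items := by simpa [HasItem] using h
  chain := by simp
  start := rfl
  finish := rfl

theorem IsWalk.wait {v : V} {t : ℕ} (h : B.IsWalk r (v, t) w) (ht : t + 1 ∈ B.γ v) :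
    B.IsWalk r (v, t + 1) (w ++ [.vertex v (t + 1)]) where
  items := by
    intro s hs
    rcases List.mem_append.1 hs with hs | hs
    · exact h.items s hs
    · rw [List.mem_singleton.1 hs]
      exact ht
  chain := by
    refine List.isChain_append.2 ⟨h.chain, by simp, fun x hx y hy => ?_⟩
    rw [h.finish] at hx
    obtain rfl := Option.some.inj hx
    obtain rfl := Option.some.inj hy
    exact ⟨rfl, rfl⟩
  start := by rw [List.head?_append, h.start]; rfl
  finish := by simp

theorem IsWalk.step {e : E} {t t' : ℕ} (h : B.IsWalk r (G.src e, t) w) (he : (t, t') ∈ B.lam e) :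
    B.IsWalk r (G.tgt e, t') (w ++ [.edge e t t', .vertex (G.tgt e) t']) where
  items := by
    intro s hs
    rcases List.mem_append.1 hs with hs | hs
    · exact h.items s hs
    · simp only [List.mem_cons, List.not_mem_nil, or_false] at hs
      rcases hs with rfl | rfl
      · exact he
      · exact B.lam_tgt e t t' he
  chain := by
    refine List.isChain_append.2 ⟨h.chain, by simp, fun x hx y hy => ?_⟩
    rw [h.finish] at hx
    obtain rfl := Option.some.inj hx
    obtain rfl := Option.some.inj hy
    exact ⟨rfl, rfl⟩
  start := by rw [List.head?_append, h.start]; rfl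
  finish := by simp

theorem IsWalk.ne_nil {z : V × ℕ} (h : B.IsWalk r z w) : w ≠ [] := by
  rintro rfl
  simpa using h.start

theorem IsWalk.finish_mem {z : V × ℕ} (h : B.IsWalk r z w) : z.2 ∈ B.γ z.1 :=
  h.items _ (List.mem_of_getLast? h.finish)

theorem IsWalk.dropLast {z z' : V × ℕ} {l : List (WalkItem V E)} (h : B.IsWalk r z (w ++ l))
    (hw : w.getLast? = some (.vertex z'.1 z'.2)) : B.IsWalk r z' w where
  items := fun s hs => h.items s (List.mem_append_left _ hs)
  chain := (List.isChain_append.1 h.chain).1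
  start := by
    have := h.start
    rw [List.head?_append] at this
    cases w with
    | nil => simp at hw
    | cons x w => simpa using this
  finish := hw

/-- The last step of a walk. -/
theorem IsWalk.cases_last {z : V × ℕ} (h : B.IsWalk r z w) :
    (w = [.vertex z.1 z.2] ∧ r = z) ∨
    (∃ w' t, z.2 = t + 1 ∧ w = w' ++ [.vertex z.1 z.2] ∧ B.IsWalk r (z.1, t) w') ∨
    ∃ w' e t, z.1 = G.tgt e ∧ (t, z.2) ∈ B.lam e ∧ w = w' ++ [.edge e t z.2, .vertex z.1 z.2] ∧
      B.IsWalk r (G.src e, t) w' := by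
  obtain ⟨w', rfl⟩ := List.getLast?_eq_some_iff.1 h.finish
  rcases List.eq_nil_or_concat w' with rfl | ⟨w'', x, hx⟩
  · have := h.start
    simp only [List.nil_append, List.head?_cons, Option.some.injEq, WalkItem.vertex.injEq] at this
    exact .inl ⟨rfl, (Prod.ext this.1 this.2).symm⟩
  · rw [List.concat_eq_append] at hx
    have hlast : w'.getLast? = some x := by rw [hx]; simp
    have hrel := (List.isChain_append.1 h.chain).2.2 x hlast _ rfl
    cases x with
    | vertex v t =>
      obtain ⟨h₁, h₂⟩ := hrel
      exact .inr (.inl ⟨w', t, h₂, rfl, h.dropLast (z' := (z.1, t)) (by rw [hlast, h₁])⟩)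
    | edge e t t' =>
      obtain ⟨h₁, h₂⟩ := hrel
      subst hx
      rcases List.eq_nil_or_concat w'' with rfl | ⟨w₃, y, hy⟩
      · simpa using h.start
      rw [List.concat_eq_append] at hy
      have hlast' : w''.getLast? = some y := by rw [hy]; simp
      have hrel' := (List.isChain_append.1 (List.isChain_append.1 h.chain).1).2.2 y hlast' _ rfl
      cases y with
      | vertex v s =>
        obtain ⟨h₃, h₄⟩ := hrel'
        have h' : B.IsWalk r z (w'' ++ [.edge e t t', .vertex z.1 z.2]) := by simpa using h
        refine .inr (.inr ⟨w'', e, t, h₁, ?_, by simp [h₂],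
          h'.dropLast (z' := (G.src e, t)) (by rw [hlast', h₃, h₄])⟩)
        rw [h₂]
        exact h.items (.edge e t t') (by simp)
      | edge e' s s' => exact hrel'.elim

/-- A walk that enters the set `X` does so on some temporal edge. -/
theorem IsWalk.exists_edge (X : V → Bool) (hr : X r.1 = false) {z : V × ℕ} (h : B.IsWalk r z w)
    (hz : X z.1 = true) :
    ∃ e t t', (t, t') ∈ B.lam e ∧ X (G.src e) = false ∧ X (G.tgt e) = true := by
  obtain ⟨n, hn⟩ : ∃ n, w.length ≤ n := ⟨_, le_rfl⟩
  induction n generalizing w z with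
  | zero => exact absurd (List.length_eq_zero_iff.1 (Nat.le_zero.1 hn)) h.ne_nil
  | succ n ih =>
    rcases h.cases_last with ⟨-, rfl⟩ | ⟨w', t, -, rfl, h'⟩ | ⟨w', e, t, h₁, h₂, rfl, h'⟩
    · rw [hr] at hz
      exact absurd hz (by simp)
    · exact ih h' hz (by simp at hn; omega)
    · cases hX : X (G.src e) with
      | true => exact ih h' hX (by simp at hn; omega)
      | false => exact ⟨e, t, z.2, h₂, hX, h₁ ▸ hz⟩

end TemporalSubdigraph

/-! ### Temporal-spanning branchings and forests -/

/-- The time `t` is the first one when `v` is active. -/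
def TemporalDigraph.IsFirst {V E : Type} (G : TemporalDigraph V E) (v : V) (t : ℕ) : Prop :=
  t ∈ G.γ v ∧ ∀ s ∈ G.γ v, t ≤ s

namespace TemporalDigraph

variable {V E : Type} {G : TemporalDigraph V E}

theorem IsFirst.unique {v : V} {t t' : ℕ} (h : G.IsFirst v t) (h' : G.IsFirst v t') : t = t' :=
  le_antisymm (h.2 _ h'.1) (h'.2 _ h.1)

theorem exists_isFirst {v : V} {t : ℕ} (h : t ∈ G.γ v) : ∃ t', G.IsFirst v t' :=
  ⟨(G.γ v).min' ⟨t, h⟩, Finset.min'_mem _ _, fun s hs => Finset.min'_le _ s hs⟩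

end TemporalDigraph

namespace TemporalSubdigraph

variable {V E : Type} {G : TemporalDigraph V E}

section Necessity

variable {B : TemporalSubdigraph G} {R : Finset (V × ℕ)}

theorem IsTemporalSpanningBranching.exists_walk (hB : B.IsTemporalSpanningBranching R) {v : V}
    {t : ℕ} (ht : t ∈ G.γ v) :
    ∃ r ∈ R, ∃ w, B.IsWalk r (v, t) w := by
  obtain ⟨w, ⟨r, hr, hw⟩, -⟩ := hB v t ht
  exact ⟨r, hr, w, hw⟩

theorem IsTemporalSpanningBranching.not_mem_roots (hB : B.IsTemporalSpanningBranching R) {v : V}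
    {t : ℕ} (ht : t ∈ G.γ v) (ht' : t + 1 ∈ G.γ v) : (v, t + 1) ∉ R := by
  intro hR
  obtain ⟨r, hr, w, hw⟩ := hB.exists_walk ht
  obtain ⟨_, _, _, hw'⟩ := hB.exists_walk ht'
  have := (hB v (t + 1) ht').unique ⟨r, hr, hw.wait hw'.finish_mem⟩
    ⟨_, hR, IsWalk.single (z := (v, t + 1)) hw'.finish_mem⟩
  have := congrArg List.length this
  simp [hw.ne_nil] at this

theorem IsTemporalSpanningBranching.not_mem_lam (hB : B.IsTemporalSpanningBranching R) {e : E}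
    {t t' : ℕ} (ht : t ∈ G.γ (G.tgt e)) (ht' : t + 1 ∈ G.γ (G.tgt e)) : (t', t + 1) ∉ B.lam e := by
  intro he
  obtain ⟨r, hr, w, hw⟩ := hB.exists_walk ht
  obtain ⟨r', hr', w', hw'⟩ := hB.exists_walk (B.γ_subset _ (B.lam_src e _ _ he))
  have h := (hB (G.tgt e) (t + 1) ht').unique ⟨r, hr, hw.wait (B.lam_tgt e _ _ he)⟩
    ⟨r', hr', hw'.step he⟩
  rw [List.append_cons w', List.append_left_inj] at h
  have := hw.finish
  rw [h] at this
  simp at this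

end Necessity

/-- The temporal subdigraph with all temporal vertices, and with the copy `p e` of each edge `e ∈ S`. -/
def ofEdges [Fintype V] [DecidableEq E] (G : TemporalDigraph V E) (S : Finset E) (p : E → ℕ × ℕ)
    (hp : ∀ e ∈ S, p e ∈ G.lam e) : TemporalSubdigraph G where
  verts := Finset.univ
  edges := S
  src_mem := by simp
  tgt_mem := by simp
  γ := G.γ
  γ_subset _ := subset_rfl
  γ_off := by simp
  lam e := if e ∈ S then {p e} else ∅
  lam_subset e := by
    split_ifs with h
    · simpa using hp e h
    · simp
  lam_off e he := if_neg he
  lam_src e t t' h := by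
    split_ifs at h with he
    · rw [Finset.mem_singleton] at h
      exact G.lam_src e t t' (h ▸ hp e he)
    · simp at h
  lam_tgt e t t' h := by
    split_ifs at h with he
    · rw [Finset.mem_singleton] at h
      exact G.lam_tgt e t t' (h ▸ hp e he)
    · simp at h

section Sufficiency

variable [Fintype V] [DecidableEq E] {S : Finset E} {p : E → ℕ × ℕ} {hp : ∀ e ∈ S, p e ∈ G.lam e}
  {R : Finset (V × ℕ)}

theorem mem_lam_ofEdges {e : E} {a : ℕ × ℕ} : a ∈ (ofEdges G S p hp).lam e ↔ e ∈ S ∧ a = p e := by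
  simp only [ofEdges]
  split_ifs with h <;> simp [h]

/-- After its first time, a vertex is reached by waiting. -/
theorem IsWalk.exists_wait (hG : ∀ v, ∀ a ∈ G.γ v, ∀ b ∈ G.γ v, ∀ t, a ≤ t → t ≤ b → t ∈ G.γ v)
    {r : V × ℕ} {v : V} {a : ℕ} {w : List (WalkItem V E)} (h : (ofEdges G S p hp).IsWalk r (v, a) w)
    {t : ℕ} (hat : a ≤ t) (ht : t ∈ G.γ v) : ∃ w, (ofEdges G S p hp).IsWalk r (v, t) w := by
  induction t, hat using Nat.le_induction with
  | base => exact ⟨w, h⟩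
  | succ t hat ih =>
    obtain ⟨w', hw'⟩ := ih (hG v a h.finish_mem _ ht t hat t.le_succ)
    exact ⟨_, hw'.wait ht⟩

theorem ofEdges_isTemporalSpanningBranching
    (hG : ∀ v, ∀ a ∈ G.γ v, ∀ b ∈ G.γ v, ∀ t, a ≤ t → t ≤ b → t ∈ G.γ v)
    (hS : ∀ e ∈ S, G.IsFirst (G.tgt e) (p e).2) (hR : ∀ r ∈ R, G.IsFirst r.1 r.2)
    (hinj : ∀ e ∈ S, ∀ e' ∈ S, G.tgt e = G.tgt e' → e = e')
    (hroot : ∀ e ∈ S, ∀ r ∈ R, r.1 ≠ G.tgt e)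
    (hreach : ∀ v t, G.IsFirst v t → ∃ r ∈ R, ∃ w, (ofEdges G S p hp).IsWalk r (v, t) w) :
    (ofEdges G S p hp).IsTemporalSpanningBranching R := by
  intro u i hi
  obtain ⟨a, ha⟩ := G.exists_isFirst hi
  obtain ⟨r, hr, w, hw⟩ := hreach u a ha
  obtain ⟨w, hw⟩ := hw.exists_wait hG (ha.2 i hi) hi
  refine ⟨w, ⟨r, hr, hw⟩, ?_⟩
  rintro w' ⟨r', hr', hw'⟩
  obtain ⟨n, hn⟩ : ∃ n, w.length ≤ n := ⟨_, le_rfl⟩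
  clear ha hi
  generalize hz : (u, i) = z at hw hw'
  clear hz
  -- The last step of a walk to a temporal vertex is determined by that temporal vertex.
  induction n generalizing w w' z with
  | zero => exact absurd (List.length_eq_zero_iff.1 (Nat.le_zero.1 hn)) hw.ne_nil
  | succ n ih =>
    have hwait : ∀ {t w₁ r₁}, z.2 = t + 1 → (ofEdges G S p hp).IsWalk r₁ (z.1, t) w₁ →
        ¬ G.IsFirst z.1 z.2 := fun ht h₁ h₂ => by
      have : _ ≤ _ := h₂.2 _ h₁.finish_mem
      simp only at this
      omega
    rcases hw.cases_last with ⟨h₁, rfl⟩ | ⟨w₁, t₁, h₁, h₂, h₃⟩ | ⟨w₁, e₁, t₁, h₁, h₂, h₃, h₄⟩ <;>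
    rcases hw'.cases_last with ⟨k₁, rfl⟩ | ⟨w₂, t₂, k₁, k₂, k₃⟩ | ⟨w₂, e₂, t₂, k₁, k₂, k₃, k₄⟩
    · rw [h₁, k₁]
    · exact absurd (hR _ hr) (hwait k₁ k₃)
    · exact absurd k₁ (hroot _ (mem_lam_ofEdges.1 k₂).1 _ hr)
    · exact absurd (hR _ hr') (hwait h₁ h₃)
    · obtain rfl : t₁ = t₂ := by omega
      rw [h₂, k₂, ih w₁ w₂ (by rw [h₂] at hn; simp at hn; omega) _ h₃ k₃]
    · obtain ⟨k₅, k₆⟩ := mem_lam_ofEdges.1 k₂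
      have := hS _ k₅
      rw [← k₆, ← k₁] at this
      exact absurd this (hwait h₁ h₃)
    · exact absurd h₁ (hroot _ (mem_lam_ofEdges.1 h₂).1 _ hr')
    · obtain ⟨h₅, h₆⟩ := mem_lam_ofEdges.1 h₂
      have := hS _ h₅
      rw [← h₆, ← h₁] at this
      exact absurd this (hwait k₁ k₃)
    · obtain ⟨h₅, h₆⟩ := mem_lam_ofEdges.1 h₂
      obtain ⟨k₅, k₆⟩ := mem_lam_ofEdges.1 k₂
      obtain rfl := hinj _ h₅ _ k₅ (h₁.symm.trans k₁)
      obtain rfl : t₁ = t₂ := congrArg Prod.fst (h₆.trans k₆.symm)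
      rw [h₃, k₃, ih w₁ w₂ (by rw [h₃] at hn; simp at hn; omega) _ h₄ k₄]

end Sufficiency

end TemporalSubdigraph

/-! ### The algorithm -/

/-- An instance as it is written down: the lists of times of the vertices; the tail, the head and the
list of copies of each edge; the lists of roots. -/
abbrev RawInstance : Type := List (List ℕ) × List (ℕ × ℕ × List (ℕ × ℕ)) × List (List (ℕ × ℕ))

/-- The element of a list without predecessor in it; for an interval this is the least one. -/
def firstTime (l : List ℕ) : Option ℕ := l.find? fun t => l.all fun s => !decide (s + 1 = t)

/-- The vertices that are active at some time, each with the first such time. -/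
def firstTimes (gs : List (List ℕ)) : List (ℕ × ℕ) :=
  gs.zipIdx.filterMap fun x => (firstTime x.1).map fun t => (x.2, t)

/-- The edges that have a copy which arrives in its head at the first time of this vertex. Such an
edge is labelled by its number and by one of these copies. -/
def usableEdges (gs : List (List ℕ)) (es : List (ℕ × ℕ × List (ℕ × ℕ))) :
    List (ℕ × ℕ × ℕ × ℕ × ℕ) :=
  es.zipIdx.filterMap fun x => (x.1.2.2.find? fun p => decide ((x.1.2.1, p.2) ∈ firstTimes gs)).map
    fun p => (x.1.1, x.1.2.1, x.2, p)

/-- A temporal subdigraph as it is written down, given the list of its usable edges: the vertices keep all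
their times, and each edge keeps the chosen copy. -/
def writeSubdigraph (gs : List (List ℕ)) (T : List (ℕ × ℕ × ℕ × ℕ × ℕ)) :
    List (ℕ × List ℕ) × List (ℕ × List (ℕ × ℕ)) :=
  (gs.zipIdx.map fun x => (x.2, x.1), T.map fun e => (e.2.2.1, [e.2.2.2]))

/-- The algorithm: if all roots are first times of their vertices, search for edge-disjoint branchings in the
static digraph of the usable edges. -/
def solve (I : RawInstance) : Option (List (List (ℕ × List ℕ) × List (ℕ × List (ℕ × ℕ)))) :=
  if I.2.2.all fun R => R.all fun r => decide (r ∈ firstTimes I.1) then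
    (pack ((firstTimes I.1).map Prod.fst) (usableEdges I.1 I.2.1)
      (I.2.2.map fun R => R.map Prod.fst)).map fun Ts => Ts.map (writeSubdigraph I.1)
  else none

namespace PolyFun

variable {α β γ : Type} [Enc α] [Enc β] [Enc γ]

theorem optionMap {f : α → Option β} {h : α → β → γ} (hf : PolyFun f)
    (hh : PolyFun fun x : α × β => h x.1 x.2) : PolyFun (fun a => (f a).map (h a)) :=
  (hf.optionElim (g := fun _ => none) (h := fun a b => Option.some (h a b)) (const none)
    hh.some).of_enc_eq fun a => by cases f a <;> rfl

theorem firstTime : PolyFun firstTime :=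
  find? PolyFun.id (k := fun l t => l.all fun s => !decide (s + 1 = t))
    (all PolyFun.id.fst (k := fun (x : List ℕ × ℕ) s => !decide (s + 1 = x.2))
      (PolyFun.id.snd.succ.decide_eq PolyFun.id.fst.snd).not)

theorem firstTimes : PolyFun firstTimes :=
  filterMap (f := List.zipIdx) PolyFun.id.zipIdx
    (k := fun _ (x : List ℕ × ℕ) => (_root_.firstTime x.1).map fun t => (x.2, t))
    (optionMap (firstTime.comp PolyFun.id.snd.fst)
      (h := fun (x : List (List ℕ) × List ℕ × ℕ) t => (x.2.2, t)) (PolyFun.id.fst.snd.snd.pair PolyFun.id.snd))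

theorem usableEdges : PolyFun fun I : RawInstance => usableEdges I.1 I.2.1 := by
  refine filterMap PolyFun.id.snd.fst.zipIdx
    (k := fun (I : RawInstance) (x : (ℕ × ℕ × List (ℕ × ℕ)) × ℕ) => (x.1.2.2.find? fun p =>
      decide ((x.1.2.1, p.2) ∈ _root_.firstTimes I.1)).map fun p => (x.1.1, x.1.2.1, x.2, p))
    (optionMap (find? PolyFun.id.snd.fst.snd.snd
      (k := fun (x : RawInstance × (ℕ × ℕ × List (ℕ × ℕ)) × ℕ) p =>
        decide ((x.2.1.2.1, p.2) ∈ _root_.firstTimes x.1.1)) ?_)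
      (h := fun (x : RawInstance × (ℕ × ℕ × List (ℕ × ℕ)) × ℕ) p =>
        (x.2.1.1, x.2.1.2.1, x.2.2, p)) ?_)
  · have h : PolyFun fun x : (RawInstance × (ℕ × ℕ × List (ℕ × ℕ)) × ℕ) × ℕ × ℕ =>
        (x.1.2.1.2.1, x.2.2) := PolyFun.id.fst.snd.fst.snd.fst.pair PolyFun.id.snd.snd
    exact h.mem (firstTimes.comp PolyFun.id.fst.fst.fst)
  · exact PolyFun.id.fst.snd.fst.fst.pair (PolyFun.id.fst.snd.fst.snd.fst.pair
      (PolyFun.id.fst.snd.snd.pair PolyFun.id.snd))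

theorem writeSubdigraph {f : α → List (List ℕ)} {T : α → List (ℕ × ℕ × ℕ × ℕ × ℕ)} (hf : PolyFun f)
    (hT : PolyFun T) : PolyFun fun a => writeSubdigraph (f a) (T a) :=
  (map hf.zipIdx (k := fun _ (x : List ℕ × ℕ) => (x.2, x.1)) (PolyFun.id.snd.snd.pair PolyFun.id.snd.fst)).pair
    (map hT (k := fun _ (e : ℕ × ℕ × ℕ × ℕ × ℕ) => (e.2.2.1, [e.2.2.2]))
      (PolyFun.id.snd.snd.snd.fst.pair (PolyFun.id.snd.snd.snd.snd.cons (const []))))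

theorem solve : PolyFun solve := by
  have hroots : PolyFun fun x : RawInstance × List (ℕ × ℕ) =>
      x.2.all fun r => decide (r ∈ _root_.firstTimes x.1.1) :=
    all PolyFun.id.snd (k := fun (x : RawInstance × List (ℕ × ℕ)) r => decide (r ∈ _root_.firstTimes x.1.1))
      (PolyFun.id.snd.mem (firstTimes.comp PolyFun.id.fst.fst.fst))
  have hroots' : PolyFun fun I : RawInstance => I.2.2.map fun R => R.map Prod.fst :=
    map (β := List (ℕ × ℕ)) PolyFun.id.snd.snd (k := fun _ R => R.map Prod.fst)
      (map (β := ℕ × ℕ) PolyFun.id.snd (k := fun _ r => r.1) PolyFun.id.snd.fst)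
  have hW : PolyFun fun I : RawInstance => (_root_.firstTimes I.1).map Prod.fst :=
    map (firstTimes.comp PolyFun.id.fst) (k := fun _ r => r.1) PolyFun.id.snd.fst
  exact ite (all PolyFun.id.snd.snd (k := fun (I : RawInstance) R =>
      R.all fun r => decide (r ∈ _root_.firstTimes I.1)) hroots)
    (optionMap (pack hW usableEdges hroots')
      (h := fun (I : RawInstance) Ts => Ts.map (_root_.writeSubdigraph I.1))
      (map PolyFun.id.snd (k := fun (x : RawInstance × List (List (ℕ × ℕ × ℕ × ℕ × ℕ))) T =>
        _root_.writeSubdigraph x.1.1 T) (writeSubdigraph PolyFun.id.fst.fst.fst PolyFun.id.snd)))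
    (const none)

end PolyFun

/-! ### Correctness of the algorithm -/

theorem List.zipIdx_ofFn {α : Type} {n : ℕ} (f : Fin n → α) :
    (List.ofFn f).zipIdx = (List.finRange n).map fun i => (f i, i.val) := by
  apply List.ext_getElem <;> simp

theorem IsForest.head_injOn {α β : Type} {R U : List α} {T : List (α × α × β)} (h : IsForest R U T) :
    ∀ x ∈ T, ∀ y ∈ T, x.2.1 = y.2.1 → x = y := by
  induction h with
  | nil => simp
  | @cons U T e h _ h₂ ih =>
    have hT : ∀ x ∈ T, x.2.1 ≠ e.2.1 := fun x hx hxe => h₂ ((h.mem_iff _).2 (.inr ⟨x, hx, hxe⟩))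
    intro x hx y hy hxy
    rcases List.mem_cons.1 hx with hx | hx <;> rcases List.mem_cons.1 hy with hy | hy
    · rw [hx, hy]
    · exact absurd (hx ▸ hxy.symm) (hT y hy)
    · exact absurd (hy ▸ hxy) (hT x hx)
    · exact ih x hx y hy hxy

theorem IsForest.head_not_mem_roots {α β : Type} {R U : List α} {T : List (α × α × β)}
    (h : IsForest R U T) : ∀ x ∈ T, x.2.1 ∉ R := by
  induction h with
  | nil => simp
  | cons h _ h₂ ih =>
    intro x hx hR
    rcases List.mem_cons.1 hx with rfl | hx
    · exact h₂ ((h.mem_iff _).2 (.inl hR))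
    · exact ih x hx hR

/-- Lists of the elements of the finite sets of which an instance consists. -/
structure Listing (I : BranchingInstance) where
  γ : Fin I.n → List ℕ
  lam : Fin I.m → List (ℕ × ℕ)
  roots : Fin I.k → List (Fin I.n × ℕ)
  mem_γ : ∀ v t, t ∈ γ v ↔ t ∈ I.graph.γ v
  mem_lam : ∀ e p, p ∈ lam e ↔ p ∈ I.graph.lam e
  mem_roots : ∀ i r, r ∈ roots i ↔ r ∈ I.roots i

namespace Listing

variable {I : BranchingInstance} (D : Listing I)

/-- The instance as it is written down by means of these lists. -/
def raw : RawInstance :=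
  (List.ofFn D.γ, List.ofFn fun e => ((I.graph.src e).val, (I.graph.tgt e).val, D.lam e),
    List.ofFn fun i => (D.roots i).map fun r => (r.1.val, r.2))

theorem exists_of_encodes {x : BinTree} (h : I.Encodes x) : ∃ D : Listing I, x = enc D.raw := by
  obtain ⟨g, h, r, hg, hh, hr, rfl⟩ := h
  choose γ hγ hγ' using hg
  choose lam hlam hlam' using hh
  choose roots hroots hroots' using hr
  refine ⟨⟨γ, lam, roots, hγ, hlam, hroots⟩, ?_⟩
  simp only [enc, raw, List.map_ofFn, Function.comp_def, List.map_map, BinTree.cons.injEq]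
  refine ⟨?_, ?_, ?_⟩
  · exact congrArg _ (congrArg _ (funext hγ'))
  · exact congrArg _ (congrArg _ (funext fun e => by rw [hlam' e]; rfl))
  · exact congrArg _ (congrArg _ (funext fun i => by rw [hroots' i]; rfl))

theorem firstTime_eq_some_iff (hI : I.IntervalActivity) {v : Fin I.n} {t : ℕ} :
    firstTime (D.γ v) = some t ↔ I.graph.IsFirst v t := by
  have key : ∀ t, firstTime (D.γ v) = some t → I.graph.IsFirst v t := by
    intro t h
    have h₁ := List.mem_of_find?_eq_some h
    have h₂ := List.find?_some h
    simp only [List.all_eq_true, Bool.not_eq_true', decide_eq_false_iff_not, D.mem_γ] at h₁ h₂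
    refine ⟨h₁, fun s hs => ?_⟩
    by_contra! hst
    exact h₂ (t - 1) (hI v s hs t h₁ (t - 1) (by omega) (by omega)) (by omega)
  refine ⟨key t, fun h => ?_⟩
  cases hf : firstTime (D.γ v) with
  | some t' => rw [h.unique (key t' hf)]
  | none =>
    have := List.find?_eq_none.1 hf t ((D.mem_γ v t).2 h.1)
    simp only [List.all_eq_true, Bool.not_eq_true', decide_eq_false_iff_not, D.mem_γ] at this
    exact absurd (fun s hs => by have := h.2 s hs; omega) this

theorem mem_firstTimes (hI : I.IntervalActivity) {v : ℕ} {t : ℕ} :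
    (v, t) ∈ firstTimes D.raw.1 ↔ ∃ v' : Fin I.n, v'.val = v ∧ I.graph.IsFirst v' t := by
  simp only [firstTimes, raw, List.zipIdx_ofFn, List.mem_filterMap, List.mem_map, List.mem_finRange,
    true_and, exists_exists_eq_and, Option.map_eq_some_iff, Prod.mk.injEq, D.firstTime_eq_some_iff hI]
  exact exists_congr fun v' => ⟨fun ⟨_, h, h₁, h₂⟩ => ⟨h₁, h₂ ▸ h⟩, fun ⟨h₁, h⟩ => ⟨t, h, h₁, rfl⟩⟩

theorem mem_firstTimes_val (hI : I.IntervalActivity) {v : Fin I.n} {t : ℕ} :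
    (v.val, t) ∈ firstTimes D.raw.1 ↔ I.graph.IsFirst v t := by
  rw [D.mem_firstTimes hI]
  exact ⟨fun ⟨_, h₁, h₂⟩ => Fin.ext h₁ ▸ h₂, fun h => ⟨v, rfl, h⟩⟩

theorem mem_map_fst_firstTimes (hI : I.IntervalActivity) {v : ℕ} :
    v ∈ (firstTimes D.raw.1).map Prod.fst ↔ ∃ (v' : Fin I.n) (t : ℕ), v'.val = v ∧ I.graph.IsFirst v' t := by
  simp only [List.mem_map, Prod.exists, exists_and_right, exists_eq_right, D.mem_firstTimes hI]
  exact exists_comm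

/-- The copy of the edge `e` that may be used. -/
def copyOf (e : Fin I.m) : Option (ℕ × ℕ) :=
  (D.lam e).find? fun p => decide (((I.graph.tgt e).val, p.2) ∈ firstTimes D.raw.1)

theorem copyOf_spec (hI : I.IntervalActivity) {e : Fin I.m} {p : ℕ × ℕ} (h : D.copyOf e = some p) :
    p ∈ I.graph.lam e ∧ I.graph.IsFirst (I.graph.tgt e) p.2 :=
  ⟨(D.mem_lam e p).1 (List.mem_of_find?_eq_some h), (D.mem_firstTimes_val hI).1 (by
    simpa using List.find?_some h)⟩

theorem exists_copyOf (hI : I.IntervalActivity) {e : Fin I.m} {p : ℕ × ℕ} (hp : p ∈ I.graph.lam e)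
    (hfirst : I.graph.IsFirst (I.graph.tgt e) p.2) : ∃ p', D.copyOf e = some p' := by
  refine Option.isSome_iff_exists.1 (List.find?_isSome.2 ⟨p, (D.mem_lam e p).2 hp, ?_⟩)
  exact decide_eq_true ((D.mem_firstTimes_val hI).2 hfirst)

theorem usableEdges_raw : usableEdges D.raw.1 D.raw.2.1 = (List.finRange I.m).filterMap fun e =>
    (D.copyOf e).map fun p => ((I.graph.src e).val, (I.graph.tgt e).val, e.val, p) := by
  rw [usableEdges, show D.raw.2.1 = List.ofFn fun e =>
    ((I.graph.src e).val, (I.graph.tgt e).val, D.lam e) from rfl, List.zipIdx_ofFn, List.filterMap_map]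
  rfl

theorem mem_usableEdges {x : ℕ × ℕ × ℕ × ℕ × ℕ} : x ∈ usableEdges D.raw.1 D.raw.2.1 ↔
    ∃ e p, D.copyOf e = some p ∧ ((I.graph.src e).val, (I.graph.tgt e).val, e.val, p) = x := by
  simp [usableEdges_raw]

theorem nodup_usableEdges : (usableEdges D.raw.1 D.raw.2.1).Nodup := by
  rw [usableEdges_raw]
  refine (List.nodup_finRange _).filterMap fun e e' x hx hx' => ?_
  simp only [Option.mem_def, Option.map_eq_some_iff] at hx hx'
  obtain ⟨p, -, rfl⟩ := hx
  obtain ⟨p', -, h⟩ := hx'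
  simp only [Prod.mk.injEq] at h
  exact Fin.ext h.2.2.1.symm

theorem usableEdges_ends (hI : I.IntervalActivity) : ∀ x ∈ usableEdges D.raw.1 D.raw.2.1,
    x.1 ∈ (firstTimes D.raw.1).map Prod.fst ∧ x.2.1 ∈ (firstTimes D.raw.1).map Prod.fst := by
  intro x hx
  obtain ⟨e, p, h, rfl⟩ := D.mem_usableEdges.1 hx
  obtain ⟨h₁, h₂⟩ := D.copyOf_spec hI h
  obtain ⟨t, ht⟩ := I.graph.exists_isFirst (I.graph.lam_src e p.1 p.2 h₁)
  exact ⟨(D.mem_map_fst_firstTimes hI).2 ⟨_, t, rfl, ht⟩, (D.mem_map_fst_firstTimes hI).2 ⟨_, _, rfl, h₂⟩⟩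

/-- The edges of the digraph to which the list `T` refers. -/
def edgesOf (m : ℕ) (T : List (ℕ × ℕ × ℕ × ℕ × ℕ)) : Finset (Fin m) :=
  Finset.univ.filter fun e => e.val ∈ T.map fun x => x.2.2.1

/-- The temporal subdigraph to which the list `T` of usable edges refers. -/
def subdigraph (hI : I.IntervalActivity) (T : List (ℕ × ℕ × ℕ × ℕ × ℕ))
    (hT : T ⊆ usableEdges D.raw.1 D.raw.2.1) : TemporalSubdigraph I.graph :=
  .ofEdges I.graph (edgesOf I.m T) (fun e => (D.copyOf e).getD (0, 0)) fun e he => by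
    simp only [edgesOf, Finset.mem_filter, Finset.mem_univ, true_and, List.mem_map] at he
    obtain ⟨x, hx, hxe⟩ := he
    obtain ⟨e', p, h, rfl⟩ := D.mem_usableEdges.1 (hT hx)
    obtain rfl := Fin.ext hxe
    rw [h]
    exact (D.copyOf_spec hI h).1

variable {D} {T : List (ℕ × ℕ × ℕ × ℕ × ℕ)}

theorem mem_edgesOf (hT : T ⊆ usableEdges D.raw.1 D.raw.2.1) {e : Fin I.m} : e ∈ edgesOf I.m T ↔
    ∃ p, D.copyOf e = some p ∧ ((I.graph.src e).val, (I.graph.tgt e).val, e.val, p) ∈ T := by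
  simp only [edgesOf, Finset.mem_filter, Finset.mem_univ, true_and, List.mem_map]
  constructor
  · rintro ⟨x, hx, hxe⟩
    obtain ⟨e', p, h, rfl⟩ := D.mem_usableEdges.1 (hT hx)
    obtain rfl := Fin.ext hxe
    exact ⟨p, h, hx⟩
  · rintro ⟨p, -, h⟩
    exact ⟨_, h, rfl⟩

/-- A forest of usable edges gives a temporal-spanning branching. -/
theorem subdigraph_isTemporalSpanningBranching (hI : I.IntervalActivity)
    (hT : T ⊆ usableEdges D.raw.1 D.raw.2.1) {i : Fin I.k}
    (hR : ∀ r ∈ I.roots i, I.graph.IsFirst r.1 r.2) {U : List ℕ}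
    (hforest : IsForest ((D.roots i).map fun r => r.1.val) U T)
    (hU : ∀ v ∈ (firstTimes D.raw.1).map Prod.fst, v ∈ U) :
    (D.subdigraph hI T hT).IsTemporalSpanningBranching (I.roots i) := by
  have hcopy : ∀ e ∈ edgesOf I.m T, D.copyOf e = some ((D.copyOf e).getD (0, 0)) := fun e he => by
    obtain ⟨p, h, -⟩ := (mem_edgesOf hT).1 he
    rw [h]; rfl
  refine TemporalSubdigraph.ofEdges_isTemporalSpanningBranching hI
    (fun e he => (D.copyOf_spec hI (hcopy e he)).2) hR (fun e he e' he' hee' => ?_)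
    (fun e he r hr hre => ?_) fun v t ht => ?_
  · obtain ⟨p, -, h⟩ := (mem_edgesOf hT).1 he
    obtain ⟨p', -, h'⟩ := (mem_edgesOf hT).1 he'
    have := hforest.head_injOn _ h _ h' (by rw [hee'])
    simp only [Prod.mk.injEq] at this
    exact Fin.ext this.2.2.1
  · obtain ⟨p, -, h⟩ := (mem_edgesOf hT).1 he
    exact hforest.head_not_mem_roots _ h
      (List.mem_map.2 ⟨r, (D.mem_roots i r).2 hr, congrArg Fin.val hre⟩)
  · -- Induction along the construction of the forest.
    suffices h : ∀ (U : List ℕ) (T' : List (ℕ × ℕ × ℕ × ℕ × ℕ)),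
        IsForest ((D.roots i).map fun r => r.1.val) U T' → T' ⊆ T → ∀ v : Fin I.n, v.val ∈ U →
        ∀ t, I.graph.IsFirst v t →
          ∃ r ∈ I.roots i, ∃ w, (D.subdigraph hI T hT).IsWalk r (v, t) w from
      h U T hforest (List.Subset.refl T) v (hU _ ((D.mem_map_fst_firstTimes hI).2 ⟨v, t, rfl, ht⟩)) t ht
    intro U T' hforest
    induction hforest with
    | nil =>
      intro _ v hv t ht
      obtain ⟨r, hr, hrv⟩ := List.mem_map.1 hv
      rw [D.mem_roots] at hr
      obtain rfl := Fin.ext hrv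
      obtain rfl := ht.unique (hR r hr)
      exact ⟨r, hr, _, .single ht.1⟩
    | @cons U T' x _ h₁ _ ih =>
      intro hT' v hv t ht
      have hT'' : T' ⊆ T := fun y hy => hT' (List.mem_cons_of_mem _ hy)
      rcases List.mem_cons.1 hv with hv | hv
      · have hx : x ∈ T := hT' List.mem_cons_self
        obtain ⟨e, p, h, rfl⟩ := D.mem_usableEdges.1 (hT hx)
        obtain rfl := Fin.ext hv
        obtain ⟨h₂, h₃⟩ := D.copyOf_spec hI h
        obtain rfl := ht.unique h₃
        have h₄ := I.graph.lam_src e p.1 p.2 h₂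
        obtain ⟨s, hs⟩ := I.graph.exists_isFirst h₄
        obtain ⟨r, hr, w, hw⟩ := ih hT'' _ h₁ s hs
        obtain ⟨w', hw'⟩ := TemporalSubdigraph.IsWalk.exists_wait hI hw (hs.2 _ h₄) h₄
        refine ⟨r, hr, _, hw'.step ?_⟩
        exact TemporalSubdigraph.mem_lam_ofEdges.2 ⟨(mem_edgesOf hT).2 ⟨p, h, hx⟩, by rw [h]; rfl⟩
      · exact ih hT'' v hv t ht

theorem exists_eq_map (hT : T ⊆ usableEdges D.raw.1 D.raw.2.1) : ∃ l : List (Fin I.m),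
    T = l.map fun e =>
      ((I.graph.src e).val, (I.graph.tgt e).val, e.val, (D.copyOf e).getD (0, 0)) := by
  induction T with
  | nil => exact ⟨[], rfl⟩
  | cons x T ih =>
    obtain ⟨l, hl⟩ := ih fun y hy => hT (List.mem_cons_of_mem _ hy)
    obtain ⟨e, p, h, rfl⟩ := D.mem_usableEdges.1 (hT List.mem_cons_self)
    exact ⟨e :: l, by rw [List.map_cons, h, ← hl]; rfl⟩

theorem encodesSubdigraph (hI : I.IntervalActivity) (hT : T ⊆ usableEdges D.raw.1 D.raw.2.1) :
    BranchingInstance.EncodesSubdigraph (D.subdigraph hI T hT)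
      (enc (writeSubdigraph D.raw.1 T)) := by
  obtain ⟨l, hl⟩ := exists_eq_map hT
  have hmem : ∀ e, e ∈ l ↔ e ∈ edgesOf I.m T := fun e => by
    simp only [edgesOf, hl, List.map_map, Function.comp_def, Finset.mem_filter, Finset.mem_univ,
      true_and, List.mem_map, Fin.val_inj, exists_eq_right]
  refine ⟨fun v => enc (D.γ v),
    fun e => enc (if e ∈ edgesOf I.m T then [(D.copyOf e).getD (0, 0)] else []),
    enc (D.raw.1.zipIdx.map fun x => (x.2, x.1)), enc (T.map fun x => (x.2.2.1, [x.2.2.2])),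
    fun v => ⟨D.γ v, D.mem_γ v, rfl⟩, fun e => ⟨_, fun a => ?_, rfl⟩,
    ⟨List.finRange I.n, fun v => by simp [subdigraph, TemporalSubdigraph.ofEdges], ?_⟩,
    ⟨l, hmem, ?_⟩, rfl⟩
  · rw [subdigraph, TemporalSubdigraph.mem_lam_ofEdges]
    split_ifs with h <;> simp [h]
  · rw [raw, List.zipIdx_ofFn]
    simp only [enc, List.map_map, Function.comp_def]
  · have : T.map (fun x => (x.2.2.1, [x.2.2.2])) = l.map fun e =>
        (e.val, if e ∈ edgesOf I.m T then [(D.copyOf e).getD (0, 0)] else []) := by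
      conv_lhs => rw [hl]
      rw [List.map_map]
      refine List.map_congr_left fun e he => ?_
      rw [if_pos ((hmem e).1 he)]
      rfl
    rw [this]
    change BinTree.ofList (List.map _ _) = _
    rw [List.map_map]
    rfl

variable (D)

theorem roots_test_iff (hI : I.IntervalActivity) :
    (D.raw.2.2.all fun R => R.all fun r => decide (r ∈ firstTimes D.raw.1)) = true ↔
      ∀ i, ∀ r ∈ I.roots i, I.graph.IsFirst r.1 r.2 := by
  simp only [List.all_eq_true, decide_eq_true_eq, show D.raw.2.2 = List.ofFn fun i =>
    (D.roots i).map fun r => (r.1.val, r.2) from rfl, List.forall_mem_ofFn_iff, List.forall_mem_map,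
    D.mem_firstTimes_val hI, D.mem_roots]

theorem map_fst_roots : (D.raw.2.2.map fun R => R.map Prod.fst) =
    List.ofFn fun i => (D.roots i).map fun r => r.1.val := by
  simp [raw, List.map_ofFn, Function.comp_def]

theorem solve_sound (hI : I.IntervalActivity)
    {out : List (List (ℕ × List ℕ) × List (ℕ × List (ℕ × ℕ)))} (h : solve D.raw = some out) :
    ∃ B : I.Candidate, I.IsSolution B ∧ I.EncodesCandidate B (enc out) := by
  unfold solve at h
  split_ifs at h with hroots
  rw [D.roots_test_iff hI] at hroots
  obtain ⟨Ts, hTs, rfl⟩ := Option.map_eq_some_iff.1 h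
  rw [D.map_fst_roots] at hTs
  obtain ⟨hforest, F, hperm⟩ := pack_sound hTs
  obtain ⟨T, rfl⟩ : ∃ T : Fin I.k → List (ℕ × ℕ × ℕ × ℕ × ℕ), Ts = List.ofFn T := by
    have hlen : Ts.length = I.k := by simpa using hforest.length_eq.symm
    exact ⟨fun i => Ts[i.val], List.ext_getElem (by simpa using hlen) (by simp)⟩
  have hsub : ∀ i, T i ⊆ usableEdges D.raw.1 D.raw.2.1 := fun i x hx =>
    hperm.subset (List.mem_append_left _ (List.mem_flatten.2 ⟨T i, by simp, hx⟩))
  have hnodup := (List.nodup_append.1 (hperm.nodup_iff.2 D.nodup_usableEdges)).1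
  rw [List.nodup_flatten, List.pairwise_ofFn] at hnodup
  have hdisj : ∀ i j, i < j → ∀ e, ¬ (e ∈ edgesOf I.m (T i) ∧ e ∈ edgesOf I.m (T j)) := by
    rintro i j hij e ⟨hi, hj⟩
    obtain ⟨p, h₁, h₂⟩ := (mem_edgesOf (hsub i)).1 hi
    obtain ⟨p', h₃, h₄⟩ := (mem_edgesOf (hsub j)).1 hj
    obtain rfl := Option.some.inj (h₁.symm.trans h₃)
    exact hnodup.2 hij h₂ h₄
  refine ⟨fun i => D.subdigraph hI (T i) (hsub i), ⟨fun i => ?_, fun i j hij e he => ?_⟩,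
    fun i => enc (writeSubdigraph D.raw.1 (T i)), fun i => encodesSubdigraph hI (hsub i), ?_⟩
  · have hi := (List.forall₂_iff_get.1 hforest).2 i.val (by simp) (by simp)
    simp only [List.get_eq_getElem, List.getElem_ofFn] at hi
    obtain ⟨U, h₁, h₂⟩ := hi
    exact subdigraph_isTemporalSpanningBranching hI (hsub i) (hroots i) h₁ h₂
  · rcases lt_or_gt_of_ne hij with hij | hij
    · exact hdisj i j hij e he
    · exact hdisj j i hij e he.symm
  · simp only [enc, List.map_ofFn, Function.comp_def]

variable {D} in
/-- In a solution, all roots are first times of their vertices. -/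
theorem isFirst_of_isSolution (hI : I.IntervalActivity) {B : I.Candidate} (hB : I.IsSolution B)
    {i : Fin I.k} {r : Fin I.n × ℕ} (hr : r ∈ I.roots i) : I.graph.IsFirst r.1 r.2 := by
  have hact := I.roots_active i r hr
  refine ⟨hact, fun s hs => ?_⟩
  by_contra! hlt
  have h : r.2 - 1 + 1 = r.2 := by omega
  refine (hB.1 i).not_mem_roots (v := r.1) (t := r.2 - 1)
    (hI _ s hs _ hact _ (by omega) (by omega)) (by rwa [h]) ?_
  rwa [h]

/-- Each branching has a usable edge that enters `X`, unless `X` contains one of its roots; these edges are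
different. -/
theorem cutCondition_of_isSolution (hI : I.IntervalActivity) {B : I.Candidate} (hB : I.IsSolution B) :
    CutCondition ((firstTimes D.raw.1).map Prod.fst) (usableEdges D.raw.1 D.raw.2.1)
      (List.ofFn fun i => (D.roots i).map fun r => r.1.val) := by
  rintro X ⟨v, hv, hX⟩
  obtain ⟨v, t, rfl, ht⟩ := (D.mem_map_fst_firstTimes hI).1 hv
  have key : ∀ i : Fin I.k, (((D.roots i).map fun r => r.1.val).all fun u => !X u) = true →
      ∃ e p, e ∈ (B i).edges ∧ D.copyOf e = some p ∧ X (I.graph.src e).val = false ∧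
        X (I.graph.tgt e).val = true := by
    intro i hi
    obtain ⟨r, hr, w, hw⟩ := (hB.1 i).exists_walk ht.1
    simp only [List.all_map, List.all_eq_true, D.mem_roots, Function.comp_apply, Bool.not_eq_true'] at hi
    obtain ⟨e, s, s', he, h₁, h₂⟩ := hw.exists_edge (fun u => X u.val) (hi r hr) hX
    have hG := (B i).lam_subset e he
    have hact := I.graph.lam_tgt e s s' hG
    obtain ⟨p, hp⟩ := D.exists_copyOf hI hG ⟨hact, fun a ha => by
      by_contra! hlt
      have h : s' - 1 + 1 = s' := by omega
      refine (hB.1 i).not_mem_lam (e := e) (t := s' - 1) (t' := s)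
        (hI _ a ha _ hact _ (by omega) (by omega)) (by rwa [h]) ?_
      rwa [h]⟩
    refine ⟨e, p, ?_, hp, h₁, h₂⟩
    by_contra hnot
    rw [(B i).lam_off e hnot] at he
    simp at he
  have key' : ∀ i : Fin I.k, ∃ x : ℕ × ℕ × ℕ × ℕ × ℕ,
      (((D.roots i).map fun r => r.1.val).all fun u => !X u) = true →
      x ∈ (usableEdges D.raw.1 D.raw.2.1).filter (fun e => !X e.1 && X e.2.1) ∧
        ∃ e ∈ (B i).edges, x.2.2.1 = e.val := by
    intro i
    by_cases hi : (((D.roots i).map fun r => r.1.val).all fun u => !X u) = true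
    · obtain ⟨e, p, h₁, h₂, h₃, h₄⟩ := key i hi
      exact ⟨_, fun _ => ⟨List.mem_filter.2 ⟨D.mem_usableEdges.2 ⟨e, p, h₂, rfl⟩, by simp [h₃, h₄]⟩,
        e, h₁, rfl⟩⟩
    · exact ⟨default, fun h => absurd h hi⟩
  choose x hx using key'
  rw [inDeg, List.ofFn_eq_map, List.countP_map, List.countP_eq_length_filter,
    List.countP_eq_length_filter, ← List.length_map (f := x)]
  refine (List.subperm_of_subset ((List.nodup_map_iff_inj_on ((List.nodup_finRange _).filter _)).2
    fun i hi j hj hij => ?_) fun y hy => ?_).length_le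
  · obtain ⟨-, e, he, h₁⟩ := hx i (List.mem_filter.1 hi).2
    obtain ⟨-, e', he', h₂⟩ := hx j (List.mem_filter.1 hj).2
    obtain rfl : e = e' := Fin.ext (by rw [← h₁, ← h₂, hij])
    by_contra hne
    exact hB.2 i j hne e ⟨he, he'⟩
  · obtain ⟨i, hi, rfl⟩ := List.mem_map.1 hy
    exact (hx i (List.mem_filter.1 hi).2).1

theorem solve_complete (hI : I.IntervalActivity) (h : solve D.raw = none) (B : I.Candidate) :
    ¬ I.IsSolution B := by
  intro hB
  unfold solve at h
  rw [if_pos ((D.roots_test_iff hI).2 fun i r hr => isFirst_of_isSolution hI hB hr),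
    Option.map_eq_none_iff, D.map_fst_roots] at h
  exact pack_ne_none (D.usableEdges_ends hI) (D.cutCondition_of_isSolution hI hB) h

end Listing

/-! ### The polynomial-time algorithm -/

theorem BranchingInstance.polyTimeOn_intervalActivity :
    BranchingInstance.PolyTimeOn BranchingInstance.IntervalActivity := by
  obtain ⟨P, p, hP⟩ := PolyFun.solve
  refine ⟨P, p, fun I hI x hx => ?_⟩
  obtain ⟨D, rfl⟩ := Listing.exists_of_encodes hx
  obtain ⟨s, t, he, hs, ht⟩ := hP D.raw
    (Function.update (fun _ => BinTree.nil) 0 (enc D.raw)) (Function.update_self ..)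
  refine ⟨_, t, ⟨s, he, hs⟩, ht, ?_⟩
  cases h : solve D.raw with
  | none => exact .inr ⟨D.solve_complete hI h, rfl⟩
  | some out =>
    obtain ⟨B, hB, hz⟩ := D.solve_sound hI h
    exact .inl ⟨B, _, hB, hz, rfl⟩

theorem BranchingInstance.PolyTimeOn.mono {P Q : BranchingInstance → Prop}
    (h : BranchingInstance.PolyTimeOn Q) (hPQ : ∀ I, P I → Q I) : BranchingInstance.PolyTimeOn P := by
  obtain ⟨c, p, hc⟩ := h
  exact ⟨c, p, fun I hI => hc I (hPQ I hI)⟩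

theorem theorem5 :
    BranchingInstance.PolyTimeOn BranchingInstance.IntervalActivity ∧
    BranchingInstance.PolyTimeOn BranchingInstance.EternalVertices ∧
    BranchingInstance.PolyTimeOn BranchingInstance.LifetimeTwo := by
  refine ⟨BranchingInstance.polyTimeOn_intervalActivity,
    BranchingInstance.polyTimeOn_intervalActivity.mono ?_,
    BranchingInstance.polyTimeOn_intervalActivity.mono ?_⟩
  · rintro I ⟨T, hT⟩ v a ha b hb t hat htb
    rw [hT, Finset.mem_Icc] at *
    omega
  · intro I hI v a ha b hb t hat htb
    have h₁ := Finset.mem_Icc.1 (hI v ha)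
    have h₂ := Finset.mem_Icc.1 (hI v hb)
    obtain rfl | rfl : t = a ∨ t = b := by omega
    · exact ha
    · exact hb
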